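/- **Setting.** Let $V$ be a finite-dimensional $\mathbb{Q}$-vector space, $L\subset V$ a lattice, and $p$ a prime. Put $V_\ell=V\otimes_{\mathbb Q}\mathbb{Q}_\ell$ and $L_\ell=L\otimes_{\mathbb Z}\mathbb{Z}_\ell\subset V_\ell$ for each prime $\ell$, and $V_{\mathbb R}=V\otimes_{\mathbb Q}\mathbb{R}$. *Pseudo-measures.* Let $\mathcal{M}(L_p)$ be the space of continuous linear functionals on $C(L_p,\mathbb{Q}_p)$, a commutative ring under convolution, and let $\delta_v\in\mathcal{M}(L_p)$ be the Dirac measure at $v$. The ring of pseudo-measures is $\widetilde{\mathcal{M}}(L_p)=S^{-1}\mathcal{M}(L_p)$, where $S$ is the multiplicative set generated by the elements $\delta_0-\delta_v$, $0\neq v\in L_p$. A pseudo-measure is *a measure* if it lies in the image of $\mathcal{M}(L_p)\to\widetilde{\mathcal{M}}(L_p)$. *Test functions.* Let $\mathcal{S}(V_\ell)$ be the group of locally constant compactly supported functions $V_\ell\to\mathbb{Z}$, and let $\mathcal{S}(V^{(p)})=\bigotimes'_{\ell\neq p}\mathcal{S}(V_\ell)$ (restricted with respect to the characteristic functions $[L_\ell]$)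 be the group of test functions away from $p$. A test function $f'\in\mathcal{S}(V^{(p)})$ is evaluated at $v\in V$ by $(\bigotimes f_\ell)(v)=\prod_{\ell\ne p} f_\ell(v)$, and $(f'\otimes[L_p])(v)=f'(v)$ if $v\in L_p$ and $0$ otherwise. *Vanishing Hypothesis.* A test function $f'$ satisfies the Vanishing Hypothesis for $0\ne w\in V$ if for every $v\in V$ the function $x\mapsto f'(v+xw)$ on $\mathbb{Q}$ has Haar measure $0$ away from $p$; that is, with $g(x)=f'(v+xw)$ if $x\in\mathbb{Q}\cap\mathbb{Z}_p$ and $g(x)=0$ for other $x\in\mathbb{Q}$, and with $N\geq1$ an integer such that $g$ is $N\mathbb{Z}$-periodic, $\frac1N\sum_{x\in\mathbb{Q}/N\mathbb{Z}}g(x)=0$. *Cones.* For vectors $w_1,\dots,w_k\in V$ that are linearly independent in $V_{\mathbb R}$, put $C^o(w_1,\dots,w_k)=\{\sum a_iw_i : a_i\in\mathbb{R}_{>0}\}\subset V_{\mathbb R}$ (so $C^o(\emptyset)=\{0\}$). A (rational) *simplicial cone with extremal rays* $v_1,\dots,v_r\in V$ is a finite disjoint union $C\subset V_{\mathbb R}$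 of open cones, each generated by a linearly independent subfamily of $v_1,\dots,v_r$, such that each $v_i$ occurs as a generator of some of these open cones. *The pseudo-measure of a cone.* A pseudo-measure $\mu$ is *represented* by the formal sum $\sum_{v\in C}(f'\otimes[L_p])(v)\,q^v$ if there are a finite product $D$ of factors $1-q^w$ ($0\neq w\in V\cap L_p$) and a finite sum $N=\sum_w a_wq^w$ ($a_w\in\mathbb{Z}$, $w\in V\cap L_p$) such that $D\cdot\sum_{v\in C}(f'\otimes[L_p])(v)q^v=N$ as formal sums, and $D(\delta)\,\mu=N(\delta)$ in $\widetilde{\mathcal{M}}(L_p)$, where $D(\delta)$, $N(\delta)$ are obtained from $D,N$ by substituting $\delta_w$ for $q^w$. **Theorem.** Let $f'\in\mathcal{S}(V^{(p)})$ be a test function away from $p$ and let $C$ be a rational simplicial cone with extremal rays $v_1,\dots,v_r\in V$. If $f'$ satisfies the Vanishing Hypothesis for each of $v_1,\dots,v_r$, then the pseudo-measure $\mu_{f',C}\in\widetilde{\mathcal{M}}(L_p)$, i.e. the unique pseudo-measure represented by $\sum_{v\in C}(f'\otimes[L_p])(v)\,q^v$ (it exists and is unique), is a measure. -/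

import Mathlib

open scoped TensorProduct AbstractMeasure

noncomputable section

/-! ### The ring of `p`-adic measures on a profinite abelian group -/

namespace AbstractMeasure

section Convolution

set_option linter.unusedSectionVars false

variable {G R : Type*} [AddCommGroup G] [TopologicalSpace G] [ContinuousAdd G]
  [CompactSpace G] [T2Space G] [TotallyDisconnectedSpace G]
  [CommRing R] [TopologicalSpace R] [IsTopologicalRing R] [T0Space R]

/-- Convolution of measures: `(μ ∗ ν)(f) = ∫ (∫ f (v + w) dν(w)) dμ(v)`. -/
def conv (μ ν : D(G, R)) : D(G, R) := map ⟨fun x : G × G => x.1 + x.2, by fun_prop⟩ (prodMk' μ ν)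

theorem conv_apply (μ ν : D(G, R)) (f : C(G, R)) :
    conv μ ν f = μ (contractSnd ν (f.comp ⟨fun x : G × G => x.1 + x.2, by fun_prop⟩)) := rfl

theorem conv_comm (μ ν : D(G, R)) : conv μ ν = conv ν μ := by
  have h : prodMk' μ ν = prodMk μ ν := (prodMk_eq_prodMk' μ ν).symm
  rw [conv, h]
  refine DFunLike.ext _ _ fun f => ?_
  change ν _ = ν _
  congr 1
  ext y
  change μ _ = μ _
  congr 1
  ext x
  exact congrArg f (add_comm _ _)

theorem conv_assoc (μ ν ρ : D(G, R)) : conv (conv μ ν) ρ = conv μ (conv ν ρ) := by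
  refine DFunLike.ext _ _ fun f => ?_
  change μ _ = μ _
  congr 1
  ext x
  change ν _ = ν _
  congr 1
  ext y
  change ρ _ = ρ _
  congr 1
  ext z
  exact congrArg f (add_assoc _ _ _)

theorem one_conv (μ : D(G, R)) : conv (dirac R 0) μ = μ := by
  refine DFunLike.ext _ _ fun f => ?_
  change μ _ = μ _
  congr 1
  ext x
  exact congrArg f (zero_add _)

theorem add_conv (μ ν ρ : D(G, R)) : conv (μ + ν) ρ = conv μ ρ + conv ν ρ := by
  simp only [conv, map_add, LinearMap.add_apply]

/-- Measures on a profinite abelian group form a commutative ring under convolution, with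
`δ_0` as identity. -/
instance instCommRing : CommRing D(G, R) :=
  { (inferInstance : AddCommGroup D(G, R)) with
    mul := conv
    one := dirac R 0
    mul_assoc := conv_assoc
    mul_comm := conv_comm
    one_mul := one_conv
    mul_one := fun μ => (conv_comm _ _).trans (one_conv μ)
    right_distrib := add_conv
    left_distrib := fun μ ν ρ => by
      change conv μ (ν + ρ) = conv μ ν + conv μ ρ
      rw [conv_comm μ, add_conv, conv_comm ν, conv_comm ρ]
    zero_mul := fun μ => by
      change conv 0 μ = 0
      simp only [conv, map_zero, LinearMap.zero_apply]
    mul_zero := fun μ => by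
      change conv μ 0 = 0
      simp only [conv, map_zero] }

theorem dirac_mul_dirac (v w : G) : (dirac R v * dirac R w : D(G, R)) = dirac R (v + w) := rfl

end Convolution

end AbstractMeasure

namespace PadicShintani

universe u

/-! ### Local and real completions of a rational vector space -/

section Spaces

variable (p : ℕ) [Fact p.Prime] (V : Type u) [AddCommGroup V] [Module ℚ V]

/-- `V_p = V ⊗ ℚ_p`. -/
def LocalSpace : Type u := ℚ_[p] ⊗[ℚ] V

instance : AddCommGroup (LocalSpace p V) := inferInstanceAs (AddCommGroup (ℚ_[p] ⊗[ℚ] V))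

instance : Module ℚ_[p] (LocalSpace p V) := inferInstanceAs (Module ℚ_[p] (ℚ_[p] ⊗[ℚ] V))

instance : Module ℤ_[p] (LocalSpace p V) := Module.compHom _ (algebraMap ℤ_[p] ℚ_[p])

/-- The usual topology of a finite dimensional `ℚ_p`-vector space. -/
instance : TopologicalSpace (LocalSpace p V) := moduleTopology ℚ_[p] (LocalSpace p V)

instance : IsModuleTopology ℚ_[p] (LocalSpace p V) := ⟨rfl⟩

instance : IsTopologicalAddGroup (LocalSpace p V) := IsModuleTopology.topologicalAddGroup ℚ_[p] _

variable {V}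

/-- The canonical map `V → V_p`. -/
def toLocal : V →+ LocalSpace p V := (TensorProduct.mk ℚ ℚ_[p] V 1).toAddMonoidHom

/-- The lattice `L_p = L ⊗ ℤ_p`, as the `ℤ_p`-span of `L` in `V_p`. -/
def localLattice (L : Submodule ℤ V) : Submodule ℤ_[p] (LocalSpace p V) :=
  Submodule.span ℤ_[p] (toLocal p '' (L : Set V))

instance [FiniteDimensional ℚ V] : Module.Finite ℚ_[p] (LocalSpace p V) :=
  inferInstanceAs (Module.Finite ℚ_[p] (ℚ_[p] ⊗[ℚ] V))

/-- Coordinates on `V_p`. -/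
def localCoord [FiniteDimensional ℚ V] :
    LocalSpace p V ≃L[ℚ_[p]] (Fin (Module.finrank ℚ_[p] (LocalSpace p V)) → ℚ_[p]) where
  toLinearEquiv := (Module.finBasis ℚ_[p] (LocalSpace p V)).equivFun
  continuous_toFun := IsModuleTopology.continuous_of_linearMap
    (Module.finBasis ℚ_[p] (LocalSpace p V)).equivFun.toLinearMap
  continuous_invFun := IsModuleTopology.continuous_of_linearMap
    (Module.finBasis ℚ_[p] (LocalSpace p V)).equivFun.symm.toLinearMap

instance [FiniteDimensional ℚ V] : T2Space (LocalSpace p V) :=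
  (localCoord p (V := V)).toHomeomorph.isEmbedding.t2Space

instance [FiniteDimensional ℚ V] : TotallyDisconnectedSpace (LocalSpace p V) :=
  (localCoord p (V := V)).toHomeomorph.symm.totallyDisconnectedSpace

instance compactSpace_localLattice (L : Submodule ℤ V) [L.IsLattice ℚ] :
    CompactSpace (localLattice p L) := by
  obtain ⟨s, hs⟩ := Submodule.IsLattice.fg (M := L)
  let e : (s → ℤ_[p]) → LocalSpace p V :=
    fun a => ∑ i : s, ((a i : ℤ_[p]) : ℚ_[p]) • toLocal p (i : V)
  have he : Continuous e := by fun_prop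
  have hL : localLattice p L = Submodule.span ℤ_[p] (Set.range fun i : s => toLocal p (i : V)) := by
    apply le_antisymm
    · refine Submodule.span_le.2 ?_
      rintro _ ⟨x, hx, rfl⟩
      rw [← hs] at hx
      change toLocal p x ∈ Submodule.span ℤ_[p] (Set.range fun i : s => toLocal p (i : V))
      refine Submodule.span_induction (p := fun y _ => toLocal p y ∈
        Submodule.span ℤ_[p] (Set.range fun i : s => toLocal p (i : V))) ?_ ?_ ?_ ?_ hx
      · exact fun y hy => Submodule.subset_span ⟨⟨y, hy⟩, rfl⟩
      · simp
      · intro y z _ _ hy hz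
        rw [map_add]
        exact add_mem hy hz
      · intro n y _ hy
        rw [map_zsmul]
        exact zsmul_mem hy n
    · refine Submodule.span_mono ?_
      rintro _ ⟨i, rfl⟩
      refine ⟨i, ?_, rfl⟩
      rw [← hs]
      exact Submodule.subset_span i.2
  have hr : (localLattice p L : Set (LocalSpace p V)) = Set.range e := by
    ext x
    rw [SetLike.mem_coe, hL, Submodule.mem_span_range_iff_exists_fun]
    rfl
  refine isCompact_iff_compactSpace.1 ?_
  rw [hr]
  exact isCompact_range he

/-- `V_ℝ = V ⊗ ℝ`. -/
abbrev RealSpace (V : Type u) [AddCommGroup V] [Module ℚ V] : Type u := ℝ ⊗[ℚ] V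

/-- The canonical map `V → V_ℝ`. -/
def toReal : V →+ RealSpace V := (TensorProduct.mk ℚ ℝ V 1).toAddMonoidHom

end Spaces

/-! ### Measures and pseudo-measures on `L_p` -/

section Pseudo

variable (p : ℕ) [Fact p.Prime] {V : Type u} [AddCommGroup V] [Module ℚ V] [FiniteDimensional ℚ V]
  (L : Submodule ℤ V) [L.IsLattice ℚ]

/-- `ℳ(L_p)`: continuous linear functionals on the space of continuous functions `L_p → ℚ_p`. -/
abbrev Measures : Type u := D(localLattice p L, ℚ_[p])

/-- The multiplicative set generated by `δ_0 - δ_v`, for `0 ≠ v ∈ L_p`. -/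
def denominators : Submonoid (Measures p L) :=
  Submonoid.closure {μ | ∃ v : localLattice p L, v ≠ 0 ∧
    μ = AbstractMeasure.dirac ℚ_[p] 0 - AbstractMeasure.dirac ℚ_[p] v}

/-- The ring of `p`-adic pseudo-measures on `L_p`. -/
abbrev PseudoMeasures : Type u := Localization (denominators p L)

variable {p L} in
/-- A pseudo-measure is a measure if it lies in the image of `ℳ(L_p)`. -/
def IsMeasure (μ : PseudoMeasures p L) : Prop :=
  ∃ ν : Measures p L, algebraMap (Measures p L) (PseudoMeasures p L) ν = μ

/-- The points of `V` lying in `L_p`. -/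
def integralPoints : AddSubgroup V :=
  (localLattice p L).toAddSubgroup.comap (toLocal p)

/-- The Dirac measure on `L_p` at a point of `V ∩ L_p`. -/
def diracAt (v : integralPoints p L) : Measures p L :=
  AbstractMeasure.dirac ℚ_[p] ⟨toLocal p (v : V), v.2⟩

/-- The ring homomorphism `ℤ[V ∩ L_p] → ℳ(L_p)` sending `[v]` to `δ_v`. -/
def groupRingToMeasures : AddMonoidAlgebra ℤ (integralPoints p L) →+* Measures p L :=
  (AddMonoidAlgebra.lift ℤ (Measures p L) (integralPoints p L)
    { toFun := fun v => diracAt p L v.toAdd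
      map_one' := congrArg (AbstractMeasure.dirac ℚ_[p]) (Subtype.ext (map_zero (toLocal p)))
      map_mul' := fun v w => (congrArg (AbstractMeasure.dirac ℚ_[p]) (Subtype.ext
        (map_add (toLocal p) (v.toAdd : V) (w.toAdd : V)))).trans
        (AbstractMeasure.dirac_mul_dirac _ _).symm }).toRingHom

end Pseudo

/-! ### Test functions away from `p`

The restricted tensor product `⨂'_{ℓ ≠ p} 𝒮(V_ℓ)` is realised as a group of functions on `V`: a
pure tensor `⨂ f_ℓ` is the function `v ↦ ∏ f_ℓ(v)`. No information is lost, because the elements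
of the tensor product are locally constant functions on the restricted product of the `V_ℓ`,
`ℓ ≠ p`, in which `V` is dense. -/

section TestFunctions

/-- The primes different from `p`. -/
abbrev PrimesAway (p : ℕ) : Type := {ℓ : ℕ // ℓ.Prime ∧ ℓ ≠ p}

instance (p : ℕ) (ℓ : PrimesAway p) : Fact ℓ.1.Prime := ⟨ℓ.2.1⟩

variable (p : ℕ) {V : Type u} [AddCommGroup V] [Module ℚ V] (L : Submodule ℤ V)

/-- `𝒮(V_ℓ)`: locally constant functions with compact support `V_ℓ → ℤ`. -/
def IsStepFunction (ℓ : ℕ) [Fact ℓ.Prime] (f : LocalSpace ℓ V → ℤ) : Prop :=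
  IsLocallyConstant f ∧ HasCompactSupport f

/-- The characteristic function `[L_ℓ]`. -/
def latticeIndicator (ℓ : ℕ) [Fact ℓ.Prime] : LocalSpace ℓ V → ℤ :=
  (localLattice ℓ L : Set (LocalSpace ℓ V)).indicator 1

/-- Pure tensors `⨂_{ℓ ≠ p} f_ℓ` with `f_ℓ ∈ 𝒮(V_ℓ)` for all `ℓ` and `f_ℓ = [L_ℓ]` for almost all
`ℓ`. For each `v ∈ V` almost all factors `f_ℓ(v)` are equal to `1`. -/
def IsPureTensorAway (f : V → ℤ) : Prop :=
  ∃ F : ∀ ℓ : PrimesAway p, LocalSpace ℓ.1 V → ℤ,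
    (∀ ℓ : PrimesAway p, IsStepFunction (V := V) ℓ.1 (F ℓ)) ∧
    {ℓ : PrimesAway p | F ℓ ≠ latticeIndicator L ℓ.1}.Finite ∧
    ∀ v, f v = ∏ᶠ ℓ : PrimesAway p, F ℓ (toLocal (V := V) ℓ.1 v)

/-- `𝒮(V^{(p)})`, the group of test functions away from `p`. -/
def testFunctionsAway : AddSubgroup (V → ℤ) :=
  AddSubgroup.closure {f | IsPureTensorAway p L f}

end TestFunctions

/-! ### Haar measure on `𝒮(ℚ)` and the vanishing hypothesis -/

section Haar

open Classical in
/-- The Haar measure `h_ℚ(f) = [ℤ : Nℤ]⁻¹ ∑_{x ∈ ℚ/Nℤ} f(x)` of a test function `f` on `ℚ` (with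
respect to the lattice `ℤ`), where `f` is periodic with respect to `Nℤ`. It does not depend on `N`;
the least positive integer period is taken. -/
def haarRat (f : ℚ → ℤ) : ℚ :=
  if h : ∃ N : ℕ, 0 < N ∧ Function.Periodic f (N : ℚ) then
    ((Nat.find h : ℕ) : ℚ)⁻¹ *
      ∑ᶠ x : ℚ ⧸ AddSubgroup.zmultiples ((Nat.find h : ℕ) : ℚ),
        (((Nat.find_spec h).2.lift x : ℤ) : ℚ)
  else 0

variable (p : ℕ) [Fact p.Prime]

open Classical in
/-- The Haar measure away from `p`: `h^{(p)}(g) = h_ℚ(g ⊗ [ℤ_p])`. -/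
def haarAway (g : ℚ → ℤ) : ℚ :=
  haarRat fun x => if ‖(x : ℚ_[p])‖ ≤ 1 then g x else 0

/-- The vanishing hypothesis for `w`: for each `v ∈ V` the restriction `x ↦ f'(v + x w)` has Haar
measure zero. -/
def VanishingHypothesis {V : Type u} [AddCommGroup V] [Module ℚ V] (f' : V → ℤ) (w : V) : Prop :=
  ∀ v : V, haarAway p (fun x : ℚ => f' (v + x • w)) = 0

end Haar

/-! ### Cones -/

section Cones

variable {V : Type u} [AddCommGroup V] [Module ℚ V]

/-- The open cone `C^o(w_i : i ∈ ι) = {∑ a_i w_i : a_i > 0}` in `V_ℝ`. -/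
def openCone {ι : Type*} [Fintype ι] (w : ι → V) : Set (RealSpace V) :=
  {x | ∃ a : ι → ℝ, (∀ i, 0 < a i) ∧ x = ∑ i, a i • toReal (w i)}

/-- `C` is a (rational) simplicial cone with extremal rays `v_1, …, v_r`: it is a finite union of
disjoint open cones, each generated by a linearly independent subfamily of `v_1, …, v_r`, and each
`v_i` is a generator of one of these open cones. (The empty subfamily generates the cone `{0}`.) -/
def IsSimplicialCone {r : ℕ} (C : Set (RealSpace V)) (v : Fin r → V) : Prop :=
  ∃ 𝓘 : Finset (Finset (Fin r)),
    (∀ I ∈ 𝓘, LinearIndependent ℝ fun i : I => toReal (v i)) ∧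
    (∀ i, ∃ I ∈ 𝓘, i ∈ I) ∧
    (𝓘 : Set (Finset (Fin r))).PairwiseDisjoint (fun I => openCone fun i : I => v i) ∧
    C = ⋃ I ∈ 𝓘, openCone fun i : I => v i

end Cones

/-! ### The pseudo-measure attached to a cone and a test function -/

section ConePseudoMeasure

variable (p : ℕ) [Fact p.Prime] {V : Type u} [AddCommGroup V] [Module ℚ V]
  (L : Submodule ℤ V)

open Classical in
/-- The coefficients of the formal sum `∑_{v ∈ C} (f' ⊗ [L_p])(v) q^v`. All exponents `v` with a
non-zero coefficient lie in `V ∩ L_p`. -/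
def coneSeries (f' : V → ℤ) (C : Set (RealSpace V)) (v : integralPoints p L) : ℤ :=
  if toReal (v : V) ∈ C then f' v else 0

variable {p L}

/-- The product of a Laurent polynomial `D ∈ ℤ[V ∩ L_p]` and a formal sum `∑ s(v) q^v`. -/
def laurentMul (D : AddMonoidAlgebra ℤ (integralPoints p L)) (s : integralPoints p L → ℤ) :
    integralPoints p L → ℤ :=
  fun v => D.coeff.sum fun w a => a * s (v - w)

variable [FiniteDimensional ℚ V] [L.IsLattice ℚ]

/-- `μ` is the pseudo-measure represented by the formal sum `∑ s(v) q^v` (equivalently, by the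
formal sum of Dirac measures `∑ s(v) δ_v`): the formal sum is a rational function `N / D`, where `N`
is a finite sum of terms `a q^w` and `D` is a product of factors `1 - q^w`, `w ≠ 0`, and `μ` is the
quotient of the corresponding measures (`q^w` being the Amice transform of `δ_w`). -/
def Represents (s : integralPoints p L → ℤ) (μ : PseudoMeasures p L) : Prop :=
  ∃ D ∈ Submonoid.closure {d : AddMonoidAlgebra ℤ (integralPoints p L) |
      ∃ w : integralPoints p L, w ≠ 0 ∧ d = 1 - AddMonoidAlgebra.single w 1},
  ∃ N : AddMonoidAlgebra ℤ (integralPoints p L),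
    laurentMul D s = (fun v => N.coeff v) ∧
    algebraMap (Measures p L) (PseudoMeasures p L) (groupRingToMeasures p L D) * μ =
      algebraMap (Measures p L) (PseudoMeasures p L) (groupRingToMeasures p L N)

/-- `μ` is the pseudo-measure `μ_{f',C}`. -/
def IsConePseudoMeasure (f' : V → ℤ) (C : Set (RealSpace V)) (μ : PseudoMeasures p L) : Prop :=
  Represents (coneSeries p L f' C) μ

end ConePseudoMeasure

end PadicShintani

end

open PadicShintani

/-! ### Measures from integral power series, and units in the measure ring -/

namespace AbstractMeasure

/-! The series of an open cone is a priori a rational function whose denominator is a product of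
factors `1 - q^u`, one per generator. The Vanishing Hypothesis replaces these factors by
denominators that become invertible measures.

Along a ray, the hypothesis yields a positive rational multiple `u` of the generator, integral at
`p`, and an integer `M` prime to `p` such that `∑_{j<M} f'(v + j u) = 0` for every `v`
(`VanishingHypothesis.exists_integralPoint`). Multiply the series of the cone on `u_1, …, u_k` by `E
= ∏ (1 + q^{u_i} + ⋯ + q^{(M_i - 1) u_i})`. At a point whose `i`-th coordinate is at least `M_i`,
the `i`-th factor gives a full vanishing sum. So the product is supported where the coordinates lie
between `0` and `M_i`, and the level of `f'` puts its support in a fixed lattice. It is therefore a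
Laurent polynomial `G` (`finite_support_laurentMul_coneSeries`).

On the measure side, `∑_{j<M} δ_u^j` comes from the power series `∑_{j<M} (1 + X)^j`, whose constant
term `M` is a unit in `ℤ_p`. Hence `E(δ)` is a unit of the measure ring and `E(δ)⁻¹ G(δ)` is a
measure representing the series (`exists_measure_represents_openCone`). A simplicial cone is a
finite disjoint union of open ones, so these measures add up. Since a series represents at most one
pseudo-measure (`Represents.unique`), this gives the whole theorem. -/

theorem dirac_mul_apply {G R : Type*} [AddCommGroup G] [TopologicalSpace G] [ContinuousAdd G]
    [CompactSpace G] [T2Space G] [TotallyDisconnectedSpace G]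
    [CommRing R] [TopologicalSpace R] [IsTopologicalRing R] [T0Space R]
    (u : G) (μ : D(G, R)) (f : C(G, R)) :
    (dirac R u * μ) f = μ (f.comp ⟨fun x => u + x, by fun_prop⟩) := rfl

section PowerSeries

set_option linter.unusedSectionVars false

variable {p : ℕ} [Fact p.Prime] {G : Type*} [AddCommGroup G] [TopologicalSpace G]
  [IsTopologicalAddGroup G] [CompactSpace G] [T2Space G] [TotallyDisconnectedSpace G]

open Filter Topology

/-- The Mahler coefficients of `z ↦ f (φ z)`. -/
theorem tendsto_mahlerCoeff (φ : C(ℤ_[p], G)) (f : C(G, ℚ_[p])) :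
    Tendsto (fun n => (fwdDiff 1)^[n] (fun z => f (φ z)) 0) atTop (𝓝 0) := by
  have : IsBoundedSMul ℤ_[p] ℚ_[p] := .of_norm_smul_le fun r x => by
    rw [Algebra.smul_def, norm_mul]
    rfl
  exact PadicInt.fwdDiff_tendsto_zero (f.comp φ)

theorem norm_mahlerCoeff_le (φ : C(ℤ_[p], G)) (f : C(G, ℚ_[p])) (n : ℕ) :
    ‖(fwdDiff 1)^[n] (fun z => f (φ z)) 0‖ ≤ ‖f‖ :=
  (IsUltrametricDist.norm_fwdDiff_iter_apply_le 1 (f.comp φ) 0 n).trans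
    ((ContinuousMap.norm_le _ (norm_nonneg _)).2 fun z => f.norm_coe_le_norm (φ z))

theorem norm_coeff_mul_mahlerCoeff_le (φ : C(ℤ_[p], G)) (a : PowerSeries ℤ_[p])
    (f : C(G, ℚ_[p])) (n : ℕ) :
    ‖(a.coeff n : ℚ_[p]) * (fwdDiff 1)^[n] (fun z => f (φ z)) 0‖ ≤
      ‖(fwdDiff 1)^[n] (fun z => f (φ z)) 0‖ := by
  rw [norm_mul]
  exact mul_le_of_le_one_left (norm_nonneg _) (PadicInt.norm_le_one _)

theorem summable_coeff_mul_mahlerCoeff (φ : C(ℤ_[p], G)) (a : PowerSeries ℤ_[p])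
    (f : C(G, ℚ_[p])) :
    Summable fun n => (a.coeff n : ℚ_[p]) * (fwdDiff 1)^[n] (fun z => f (φ z)) 0 := by
  refine NonarchimedeanAddGroup.summable_of_tendsto_cofinite_zero ?_
  rw [Nat.cofinite_eq_atTop]
  exact squeeze_zero_norm (norm_coeff_mul_mahlerCoeff_le φ a f)
    (tendsto_zero_iff_norm_tendsto_zero.1 (tendsto_mahlerCoeff φ f))

/-- The measure on `G` obtained by pushing forward along `φ` the measure on `ℤ_p` with Amice
transform `a`. -/
noncomputable def ofPowerSeries (φ : C(ℤ_[p], G)) (a : PowerSeries ℤ_[p]) : D(G, ℚ_[p]) :=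
  toCLMEquiv.symm <| LinearMap.mkContinuous
    { toFun := fun f => ∑' n, (a.coeff n : ℚ_[p]) * (fwdDiff 1)^[n] (fun z => f (φ z)) 0
      map_add' := fun f g => by
        rw [← (summable_coeff_mul_mahlerCoeff φ a f).tsum_add
          (summable_coeff_mul_mahlerCoeff φ a g)]
        refine tsum_congr fun n => ?_
        rw [← mul_add, ← Pi.add_apply, ← fwdDiff_iter_add]
        rfl
      map_smul' := fun c f => by
        rw [RingHom.id_apply, smul_eq_mul, ← tsum_mul_left]
        refine tsum_congr fun n => ?_
        rw [mul_left_comm, ← smul_eq_mul c, ← Pi.smul_apply, ← fwdDiff_iter_const_smul]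
        rfl }
    -- Operator norm at most `1`: the coefficients of `a` and the iterated differences contribute no
    -- growth, and the norm is ultrametric.
    1 fun f => by
      rw [one_mul]
      exact IsUltrametricDist.norm_tsum_le_of_forall_le_of_nonneg (norm_nonneg f) fun n =>
        (norm_coeff_mul_mahlerCoeff_le φ a f n).trans (norm_mahlerCoeff_le φ f n)

theorem ofPowerSeries_apply (φ : C(ℤ_[p], G)) (a : PowerSeries ℤ_[p]) (f : C(G, ℚ_[p])) :
    ofPowerSeries φ a f = ∑' n, (a.coeff n : ℚ_[p]) * (fwdDiff 1)^[n] (fun z => f (φ z)) 0 := rfl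

theorem ofPowerSeries_add (φ : C(ℤ_[p], G)) (a b : PowerSeries ℤ_[p]) :
    ofPowerSeries φ (a + b) = ofPowerSeries φ a + ofPowerSeries φ b := by
  refine DFunLike.ext _ _ fun f => ?_
  change _ = ofPowerSeries φ a f + ofPowerSeries φ b f
  simp only [ofPowerSeries_apply]
  rw [← (summable_coeff_mul_mahlerCoeff φ a f).tsum_add
    (summable_coeff_mul_mahlerCoeff φ b f)]
  refine tsum_congr fun n => ?_
  rw [map_add, PadicInt.coe_add, add_mul]

theorem ofPowerSeries_one (φ : C(ℤ_[p], G)) (h0 : φ 0 = 0) : ofPowerSeries φ 1 = 1 := by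
  refine DFunLike.ext _ _ fun f => ?_
  rw [ofPowerSeries_apply, tsum_eq_single 0]
  · change _ = f 0
    simp [h0]
  · intro n hn
    simp [PowerSeries.coeff_one, hn]

/-- Translation by `u` on `G` pulls back along `φ` to the shift `1 + Δ` on functions on `ℤ_p`, and
`X` corresponds to the difference operator `Δ`. This is the only multiplicativity of the Amice
transform that is needed. -/
theorem ofPowerSeries_one_add_X_mul (φ : C(ℤ_[p], G)) (u : G) (hφ : ∀ z, φ (z + 1) = u + φ z)
    (a : PowerSeries ℤ_[p]) :
    ofPowerSeries φ ((1 + PowerSeries.X) * a) = dirac ℚ_[p] u * ofPowerSeries φ a := by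
  refine DFunLike.ext _ _ fun f => ?_
  rw [add_mul, one_mul, ofPowerSeries_add, dirac_mul_apply]
  change ofPowerSeries φ a f + ofPowerSeries φ _ f = _
  have h : ∀ n, (fwdDiff 1)^[n + 1] (fun z => f (φ z)) 0 =
      (fwdDiff 1)^[n] (fun z => f (u + φ z)) 0 - (fwdDiff 1)^[n] (fun z => f (φ z)) 0 := by
    intro n
    rw [Function.iterate_succ_apply, eq_sub_iff_add_eq, ← Pi.add_apply, ← fwdDiff_iter_add]
    refine congrFun (congrArg _ (funext fun z => ?_)) 0
    simp [fwdDiff, hφ]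
  simp only [ofPowerSeries_apply]
  rw [(summable_coeff_mul_mahlerCoeff φ _ f).tsum_eq_zero_add
    (f := fun n => ((PowerSeries.coeff n (PowerSeries.X * a) : ℤ_[p]) : ℚ_[p]) * _)]
  simp only [PowerSeries.coeff_succ_X_mul, PowerSeries.coeff_zero_X_mul, PadicInt.coe_zero,
    zero_mul, zero_add, h]
  rw [← (summable_coeff_mul_mahlerCoeff φ a f).tsum_add]
  · refine tsum_congr fun n => ?_
    rw [← mul_add, add_sub_cancel]
    rfl
  · exact ((summable_coeff_mul_mahlerCoeff φ a (f.comp ⟨fun x => u + x, by fun_prop⟩)).sub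
      (summable_coeff_mul_mahlerCoeff φ a f)).congr fun n => (mul_sub _ _ _).symm

/-- `1 + δ_u + ⋯ + δ_u^(M-1)` is a unit if `u` extends to a map from `ℤ_p` and `p ∤ M`. -/
theorem isUnit_sum_dirac_pow (φ : C(ℤ_[p], G)) (u : G) (h0 : φ 0 = 0)
    (hφ : ∀ z, φ (z + 1) = u + φ z) {M : ℕ} (hM : ¬ p ∣ M) :
    IsUnit (∑ j ∈ Finset.range M, (dirac ℚ_[p] u : D(G, ℚ_[p])) ^ j) := by
  -- The constant term is `M`, a unit in `ℤ_p`.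
  have hQ : IsUnit (∑ j ∈ Finset.range M, (1 + PowerSeries.X : PowerSeries ℤ_[p]) ^ j) := by
    rw [PowerSeries.isUnit_iff_constantCoeff]
    simp only [map_sum, map_pow, map_add, map_one, PowerSeries.constantCoeff_X, add_zero, one_pow,
      Finset.sum_const, Finset.card_range, nsmul_eq_mul, mul_one]
    rw [PadicInt.isUnit_iff, PadicInt.norm_natCast_eq_one_iff]
    exact ((Nat.Prime.coprime_iff_not_dvd Fact.out).2 hM)
  obtain ⟨a, ha⟩ := hQ.exists_right_inv
  have hpow : ∀ (j : ℕ) (b : PowerSeries ℤ_[p]), ofPowerSeries φ ((1 + PowerSeries.X) ^ j * b) =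
      (dirac ℚ_[p] u : D(G, ℚ_[p])) ^ j * ofPowerSeries φ b := by
    intro j b
    induction j with
    | zero => simp
    | succ j ih => rw [pow_succ', mul_assoc, ofPowerSeries_one_add_X_mul φ u hφ, ih, pow_succ',
        mul_assoc]
  let Φ : PowerSeries ℤ_[p] →+ D(G, ℚ_[p]) := AddMonoidHom.mk' (ofPowerSeries φ)
    (ofPowerSeries_add φ)
  refine IsUnit.of_mul_eq_one (Φ a) ?_
  rw [Finset.sum_mul, ← ofPowerSeries_one φ h0, ← ha, Finset.sum_mul]
  change _ = Φ _
  rw [map_sum]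
  exact Finset.sum_congr rfl fun j _ => (hpow j a).symm

end PowerSeries

end AbstractMeasure

namespace PadicShintani

universe u

variable (p : ℕ) [Fact p.Prime] {V : Type u} [AddCommGroup V] [Module ℚ V] [FiniteDimensional ℚ V]
  (L : Submodule ℤ V) [L.IsLattice ℚ]

instance : ContinuousSMul ℚ_[p] (LocalSpace p V) :=
  IsModuleTopology.toContinuousSMul ℚ_[p] (LocalSpace p V)

/-- The homomorphism `ℤ_p → L_p`, `z ↦ z u`. -/
noncomputable def zpMultiples (u : localLattice p L) : C(ℤ_[p], localLattice p L) where
  toFun z := z • u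
  continuous_toFun := by
    refine Continuous.subtype_mk (f := fun z : ℤ_[p] => z • (u : LocalSpace p V)) ?_ _
    change Continuous fun z : ℤ_[p] => (z : ℚ_[p]) • (u : LocalSpace p V)
    fun_prop

theorem isUnit_sum_dirac_pow (u : localLattice p L) {M : ℕ} (hM : ¬ p ∣ M) :
    IsUnit (∑ j ∈ Finset.range M, (AbstractMeasure.dirac ℚ_[p] u : Measures p L) ^ j) :=
  AbstractMeasure.isUnit_sum_dirac_pow (zpMultiples p L u) u (zero_smul _ u)
    (fun z => by
      change (z + 1) • u = u + z • u
      rw [add_smul, one_smul, add_comm]) hM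

end PadicShintani

namespace PadicShintani

universe u

/-! ### Formal series over Laurent polynomials, and uniqueness of the represented pseudo-measure -/

section FormalSeries

variable {p : ℕ} [Fact p.Prime] {V : Type u} [AddCommGroup V] [Module ℚ V] {L : Submodule ℤ V}

theorem laurentMul_single (w : integralPoints p L) (a : ℤ) (s : integralPoints p L → ℤ) :
    laurentMul (AddMonoidAlgebra.single w a) s = fun v => a * s (v - w) := by
  funext v
  rw [laurentMul, AddMonoidAlgebra.coeff_single, Finsupp.sum_single_index (zero_mul _)]

theorem laurentMul_add (D E : AddMonoidAlgebra ℤ (integralPoints p L))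
    (s : integralPoints p L → ℤ) : laurentMul (D + E) s = laurentMul D s + laurentMul E s := by
  funext v
  exact Finsupp.sum_add_index' (fun _ => zero_mul _) fun _ _ _ => add_mul _ _ _

theorem laurentMul_series_add (D : AddMonoidAlgebra ℤ (integralPoints p L))
    (s t : integralPoints p L → ℤ) : laurentMul D (s + t) = laurentMul D s + laurentMul D t := by
  funext v
  simp only [laurentMul, Pi.add_apply, mul_add]
  exact Finsupp.sum_add

theorem laurentMul_one (s : integralPoints p L → ℤ) :
    laurentMul (1 : AddMonoidAlgebra ℤ (integralPoints p L)) s = s := by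
  rw [AddMonoidAlgebra.one_def, laurentMul_single]
  simp

theorem laurentMul_sum {ι : Type*} (t : Finset ι) (D : ι → AddMonoidAlgebra ℤ (integralPoints p L))
    (s : integralPoints p L → ℤ) (v : integralPoints p L) :
    laurentMul (∑ i ∈ t, D i) s v = ∑ i ∈ t, laurentMul (D i) s v := by
  classical
  induction t using Finset.induction_on with
  | empty => rfl
  | insert i t hi ih => rw [Finset.sum_insert hi, Finset.sum_insert hi, laurentMul_add,
      Pi.add_apply, ih]

/-- Formal series cannot be multiplied with each other, but they form a module over the Laurent
polynomials. This is what justifies cross-multiplying fractions. -/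
theorem laurentMul_mul (D E : AddMonoidAlgebra ℤ (integralPoints p L))
    (s : integralPoints p L → ℤ) : laurentMul (D * E) s = laurentMul D (laurentMul E s) := by
  induction D using AddMonoidAlgebra.induction_linear with
  | zero => rw [zero_mul]; rfl
  | add D D' h h' => rw [add_mul, laurentMul_add, h, h', laurentMul_add]
  | single w a =>
    induction E using AddMonoidAlgebra.induction_linear with
    | zero => rw [mul_zero, laurentMul_single]; funext v; exact (mul_zero _).symm
    | add E E' h h' => rw [mul_add, laurentMul_add, laurentMul_add, h, h', laurentMul_series_add]
    | single w' a' =>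
      rw [AddMonoidAlgebra.single_mul_single, laurentMul_single, laurentMul_single,
        laurentMul_single]
      funext v
      change _ = a * (a' * s (v - w - w'))
      rw [mul_assoc, sub_sub]

theorem laurentMul_coeff (D E : AddMonoidAlgebra ℤ (integralPoints p L)) :
    laurentMul D (fun v => E.coeff v) = fun v => (D * E).coeff v := by
  induction D using AddMonoidAlgebra.induction_linear with
  | zero => rw [zero_mul]; rfl
  | add D D' h h' => rw [add_mul, laurentMul_add, h, h']; rfl
  | single w a =>
    rw [laurentMul_single]
    funext v
    rw [AddMonoidAlgebra.coeff_single_mul_apply, sub_eq_neg_add]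

end FormalSeries

section Injective

variable (p : ℕ) [Fact p.Prime] {V : Type u} [AddCommGroup V] [Module ℚ V]

theorem toLocal_injective : Function.Injective (toLocal p (V := V)) :=
  Module.FaithfullyFlat.tensorProduct_mk_injective (A := ℚ) (B := ℚ_[p]) V

end Injective

section Represents

variable {p : ℕ} [Fact p.Prime] {V : Type u} [AddCommGroup V] [Module ℚ V] [FiniteDimensional ℚ V]
  {L : Submodule ℤ V} [L.IsLattice ℚ]

/-- The products of factors `1 - q^w`, `w ≠ 0`. -/
noncomputable def laurentDenominators (p : ℕ) [Fact p.Prime] (L : Submodule ℤ V) :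
    Submonoid (AddMonoidAlgebra ℤ (integralPoints p L)) :=
  Submonoid.closure {d : AddMonoidAlgebra ℤ (integralPoints p L) |
      ∃ w : integralPoints p L, w ≠ 0 ∧ d = 1 - AddMonoidAlgebra.single w 1}

theorem groupRingToMeasures_single (w : integralPoints p L) :
    groupRingToMeasures p L (AddMonoidAlgebra.single w 1) = diracAt p L w := by
  rw [groupRingToMeasures]
  change AddMonoidAlgebra.lift _ _ _ _ _ = _
  rw [AddMonoidAlgebra.lift_single, one_smul]
  rfl

theorem groupRingToMeasures_mem_denominators {D : AddMonoidAlgebra ℤ (integralPoints p L)}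
    (hD : D ∈ laurentDenominators p L) : groupRingToMeasures p L D ∈ denominators p L := by
  suffices laurentDenominators p L ≤ (denominators p L).comap (groupRingToMeasures p L) from this hD
  refine (Submonoid.closure_le).2 ?_
  rintro _ ⟨w, hw, rfl⟩
  refine Submonoid.subset_closure ⟨⟨toLocal p (w : V), w.2⟩, fun h => hw ?_, ?_⟩
  · have : toLocal p (w : V) = toLocal p 0 := (congrArg Subtype.val h).trans (map_zero _).symm
    exact Subtype.ext (toLocal_injective p this)
  · rw [map_sub, map_one, groupRingToMeasures_single]
    rfl

theorem isUnit_algebraMap_groupRingToMeasures {D : AddMonoidAlgebra ℤ (integralPoints p L)}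
    (hD : D ∈ laurentDenominators p L) :
    IsUnit (algebraMap (Measures p L) (PseudoMeasures p L) (groupRingToMeasures p L D)) :=
  IsLocalization.map_units _
    (⟨_, groupRingToMeasures_mem_denominators hD⟩ : denominators p L)

/-- Both `D' N` and `D N'` equal `D D'` times the series, so they agree as Laurent polynomials. The
image of `D D'` is a unit among pseudo-measures and cancels. -/
theorem Represents.unique {s : integralPoints p L → ℤ} {μ ν : PseudoMeasures p L}
    (hμ : Represents s μ) (hν : Represents s ν) : μ = ν := by
  obtain ⟨D, hD, N, hN, h⟩ := hμ
  obtain ⟨D', hD', N', hN', h'⟩ := hν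
  have key : D' * N = D * N' := by
    refine AddMonoidAlgebra.coeff_injective (DFunLike.coe_injective ?_)
    change (fun v => (D' * N).coeff v) = fun v => (D * N').coeff v
    rw [← laurentMul_coeff, ← laurentMul_coeff, ← hN, ← hN', ← laurentMul_mul, ← laurentMul_mul,
      mul_comm]
  refine (isUnit_algebraMap_groupRingToMeasures (Submonoid.mul_mem _ hD hD')).mul_left_cancel ?_
  rw [map_mul, map_mul, mul_right_comm, h, mul_assoc, h', ← map_mul, ← map_mul, ← map_mul,
    ← map_mul, mul_comm N, key]

theorem Represents.zero : Represents (0 : integralPoints p L → ℤ) 0 := by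
  refine ⟨1, Submonoid.one_mem _, 0, ?_, ?_⟩
  · rw [laurentMul_one]
    rfl
  · simp

theorem Represents.add {s t : integralPoints p L → ℤ} {μ ν : PseudoMeasures p L}
    (hμ : Represents s μ) (hν : Represents t ν) : Represents (s + t) (μ + ν) := by
  obtain ⟨D, hD, N, hN, h⟩ := hμ
  obtain ⟨D', hD', N', hN', h'⟩ := hν
  refine ⟨D * D', Submonoid.mul_mem _ hD hD', D' * N + D * N', ?_, ?_⟩
  · rw [laurentMul_series_add, mul_comm, laurentMul_mul, hN, mul_comm, laurentMul_mul, hN',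
      laurentMul_coeff, laurentMul_coeff]
    rfl
  · simp only [map_mul, map_add] at *
    rw [← h, ← h']
    ring

theorem Represents.sum {ι : Type*} (t : Finset ι) {s : ι → integralPoints p L → ℤ}
    {μ : ι → PseudoMeasures p L} (h : ∀ i ∈ t, Represents (s i) (μ i)) :
    Represents (∑ i ∈ t, s i) (∑ i ∈ t, μ i) := by
  classical
  induction t using Finset.induction_on with
  | empty => exact .zero
  | insert i t hi ih =>
    rw [Finset.sum_insert hi, Finset.sum_insert hi]
    exact (h i (Finset.mem_insert_self i t)).add
      (ih fun j hj => h j (Finset.mem_insert_of_mem hj))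

end Represents

end PadicShintani

/-! ### Lattices and integrality, prime by prime -/

theorem Padic.norm_ratCast_le_one_iff {p : ℕ} [Fact p.Prime] {q : ℚ} :
    ‖(q : ℚ_[p])‖ ≤ 1 ↔ ¬ p ∣ q.den := by
  refine ⟨fun h hd => ?_, Padic.norm_rat_le_one⟩
  have hn : ‖((q.num : ℤ) : ℚ_[p])‖ = 1 := by
    rw [Padic.norm_intCast_eq_one_iff, Int.isCoprime_iff_nat_coprime, Int.natAbs_natCast]
    exact q.reduced.coprime_dvd_right hd
  have hlt : ‖((q.den : ℕ) : ℚ_[p])‖ < 1 := Padic.norm_natCast_lt_one_iff.2 hd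
  have hq : (q : ℚ_[p]) * ((q.den : ℕ) : ℚ_[p]) = ((q.num : ℤ) : ℚ_[p]) := by
    exact_mod_cast Rat.mul_den_eq_num q
  have := congrArg norm hq
  rw [norm_mul, hn] at this
  nlinarith [norm_nonneg (q : ℚ_[p]), norm_nonneg ((q.den : ℕ) : ℚ_[p])]

theorem Rat.exists_eq_intCast_of_forall_padic_norm_le_one {q : ℚ}
    (h : ∀ (ℓ : ℕ) [Fact ℓ.Prime], ‖(q : ℚ_[ℓ])‖ ≤ 1) : ∃ z : ℤ, q = z := by
  refine ⟨q.num, (Rat.den_eq_one_iff q).1 ?_ |>.symm⟩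
  by_contra hd
  obtain ⟨ℓ, hℓ, hdvd⟩ := Nat.exists_prime_and_dvd hd
  have : Fact ℓ.Prime := ⟨hℓ⟩
  exact Padic.norm_ratCast_le_one_iff.1 (h ℓ) hdvd

theorem Padic.norm_natCast_eq_one_of_not_dvd {p : ℕ} [Fact p.Prime] {n : ℕ} (h : ¬ p ∣ n) :
    ‖(n : ℚ_[p])‖ = 1 :=
  Padic.norm_natCast_eq_one_iff.2 ((Nat.Prime.coprime_iff_not_dvd Fact.out).2 h)

namespace PadicShintani

universe u

open Module

section LatticeBasis

variable {V : Type u} [AddCommGroup V] [Module ℚ V] {n : ℕ}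

/-- `b` is a `ℤ`-basis of the lattice `L`. -/
def IsLatticeBasis (L : Submodule ℤ V) (b : Basis (Fin n) ℚ V) : Prop :=
  ∀ v, v ∈ L ↔ ∀ i, ∃ z : ℤ, b.repr v i = z

theorem exists_isLatticeBasis [FiniteDimensional ℚ V] (L : Submodule ℤ V) [L.IsLattice ℚ] :
    ∃ (n : ℕ) (b : Basis (Fin n) ℚ V), IsLatticeBasis L b := by
  have : Module.Free ℤ L := Submodule.IsLattice.free ℚ L
  have : Module.Finite ℤ L := Submodule.IsLattice.finite ℚ L
  let c := Module.finBasis ℤ L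
  refine ⟨_, c.extendOfIsLattice ℚ, fun v => ⟨fun hv i => ⟨c.repr ⟨v, hv⟩ i, ?_⟩, fun h => ?_⟩⟩
  · have h1 : v = ∑ i, ((c.repr ⟨v, hv⟩ i : ℤ) : ℚ) • c.extendOfIsLattice ℚ i := by
      have := congrArg Subtype.val (c.sum_repr ⟨v, hv⟩)
      simp only [AddSubmonoidClass.coe_finsetSum, Submodule.coe_smul] at this
      simp only [Basis.extendOfIsLattice_apply, Int.cast_smul_eq_zsmul]
      exact this.symm
    conv_lhs => rw [h1]
    rw [Basis.repr_sum_self]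
  · choose z hz using h
    rw [← (c.extendOfIsLattice ℚ).sum_repr v]
    refine Submodule.sum_mem _ fun i _ => ?_
    rw [hz, Int.cast_smul_eq_zsmul, Basis.extendOfIsLattice_apply]
    exact Submodule.smul_mem _ _ (c i).2

variable (ℓ : ℕ) [Fact ℓ.Prime]

/-- The coordinates on `V_ℓ` with respect to a basis of `V`. -/
noncomputable def localBasis (b : Basis (Fin n) ℚ V) : Basis (Fin n) ℚ_[ℓ] (LocalSpace ℓ V) :=
  Algebra.TensorProduct.basis ℚ_[ℓ] b

theorem localBasis_apply (b : Basis (Fin n) ℚ V) (i : Fin n) :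
    localBasis ℓ b i = toLocal ℓ (b i) :=
  Algebra.TensorProduct.basis_apply b i

theorem localBasis_repr_toLocal (b : Basis (Fin n) ℚ V) (v : V) (i : Fin n) :
    (localBasis ℓ b).repr (toLocal ℓ v) i = ((b.repr v i : ℚ) : ℚ_[ℓ]) := by
  have := DFunLike.congr_fun (Algebra.TensorProduct.basis_repr_tmul b (1 : ℚ_[ℓ]) v) i
  refine Eq.trans this ?_
  simp

variable {L : Submodule ℤ V} {b : Basis (Fin n) ℚ V}

theorem IsLatticeBasis.mem_localLattice_iff (hb : IsLatticeBasis L b) (x : LocalSpace ℓ V) :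
    x ∈ localLattice ℓ L ↔ ∀ i, ‖(localBasis ℓ b).repr x i‖ ≤ 1 := by
  constructor
  · intro hx
    induction hx using Submodule.span_induction with
    | mem x hx =>
      obtain ⟨v, hv, rfl⟩ := hx
      intro i
      obtain ⟨z, hz⟩ := (hb v).1 hv i
      rw [localBasis_repr_toLocal, hz, Rat.cast_intCast]
      exact Padic.norm_int_le_one z
    | zero => simp
    | add x y _ _ hx hy =>
      intro i
      rw [map_add, Finsupp.add_apply]
      exact (Padic.nonarchimedean _ _).trans (max_le (hx i) (hy i))
    | smul a x _ hx =>
      intro i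
      change ‖(localBasis ℓ b).repr ((a : ℚ_[ℓ]) • x) i‖ ≤ 1
      rw [map_smul, Finsupp.smul_apply, smul_eq_mul, norm_mul]
      exact mul_le_one₀ (PadicInt.norm_le_one a) (norm_nonneg _) (hx i)
  · intro h
    rw [← (localBasis ℓ b).sum_repr x]
    refine Submodule.sum_mem _ fun i _ => ?_
    rw [localBasis_apply]
    refine Submodule.smul_mem (localLattice ℓ L) (⟨_, h i⟩ : ℤ_[ℓ])
      (Submodule.subset_span ⟨b i, (hb _).2 fun j => ?_, rfl⟩)
    rw [Basis.repr_self]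
    rcases eq_or_ne j i with rfl | hj
    · exact ⟨1, by simp⟩
    · exact ⟨0, by simp [hj.symm]⟩

theorem IsLatticeBasis.toLocal_mem_iff (hb : IsLatticeBasis L b) (v : V) :
    toLocal ℓ v ∈ localLattice ℓ L ↔ ∀ i, ‖((b.repr v i : ℚ) : ℚ_[ℓ])‖ ≤ 1 := by
  simp only [hb.mem_localLattice_iff ℓ, localBasis_repr_toLocal]

theorem toLocal_mem_of_mem {v : V} (hv : v ∈ L) : toLocal ℓ v ∈ localLattice ℓ L :=
  Submodule.subset_span ⟨v, hv, rfl⟩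

/-- Coordinatewise, this says that a rational number integral at every prime is an integer. -/
theorem IsLatticeBasis.mem_of_forall_toLocal_mem (hb : IsLatticeBasis L b) {v : V}
    (h : ∀ (ℓ : ℕ) [Fact ℓ.Prime], toLocal ℓ v ∈ localLattice ℓ L) : v ∈ L :=
  (hb v).2 fun i => Rat.exists_eq_intCast_of_forall_padic_norm_le_one fun ℓ _ =>
    (hb.toLocal_mem_iff ℓ v).1 (h ℓ) i

/-- Multiplication by an integer prime to `ℓ` does not affect membership in `L_ℓ`. -/
theorem IsLatticeBasis.toLocal_nsmul_mem_iff (hb : IsLatticeBasis L b) {m : ℕ} (hm : ¬ ℓ ∣ m)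
    (v : V) : toLocal ℓ (m • v) ∈ localLattice ℓ L ↔ toLocal ℓ v ∈ localLattice ℓ L := by
  rw [hb.toLocal_mem_iff ℓ, hb.toLocal_mem_iff ℓ]
  simp only [map_nsmul, Finsupp.smul_apply, nsmul_eq_mul, Rat.cast_mul,
    Rat.cast_natCast, norm_mul, Padic.norm_natCast_eq_one_of_not_dvd hm, one_mul]

theorem IsLatticeBasis.exists_nsmul_mem (hb : IsLatticeBasis L b) (v : V) :
    ∃ d : ℕ, d ≠ 0 ∧ d • v ∈ L := by
  refine ⟨∏ i, (b.repr v i).den, Finset.prod_ne_zero_iff.2 fun i _ => (b.repr v i).den_ne_zero,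
    (hb _).2 fun i => ?_⟩
  obtain ⟨c, hc⟩ := Finset.dvd_prod_of_mem (fun i => (b.repr v i).den) (Finset.mem_univ i)
  refine ⟨c * (b.repr v i).num, ?_⟩
  rw [hc, map_nsmul, Finsupp.smul_apply, nsmul_eq_mul]
  push_cast
  rw [← Rat.den_mul_eq_num]
  ring

end LatticeBasis

/-! ### Levels of test functions -/

section StepFunctions

variable {V : Type u} [AddCommGroup V] [Module ℚ V] {n : ℕ} (ℓ : ℕ) [Fact ℓ.Prime]

/-- The coordinates on `V_ℓ` as a homeomorphism. -/
noncomputable def localCoordinates (b : Basis (Fin n) ℚ V) :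
    LocalSpace ℓ V ≃L[ℚ_[ℓ]] (Fin n → ℚ_[ℓ]) where
  toLinearEquiv := (localBasis ℓ b).equivFun
  continuous_toFun := IsModuleTopology.continuous_of_linearMap
    (localBasis ℓ b).equivFun.toLinearMap
  continuous_invFun := IsModuleTopology.continuous_of_linearMap
    (localBasis ℓ b).equivFun.symm.toLinearMap

theorem IsLatticeBasis.mem_localLattice_iff_norm_le {L : Submodule ℤ V} {b : Basis (Fin n) ℚ V}
    (hb : IsLatticeBasis L b) (x : LocalSpace ℓ V) :
    x ∈ localLattice ℓ L ↔ ‖localCoordinates ℓ b x‖ ≤ 1 := by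
  rw [hb.mem_localLattice_iff ℓ, pi_norm_le_iff_of_nonneg zero_le_one]
  rfl

/-- Compact support makes `F` uniformly continuous, and an integer-valued function that varies by
less than `1` is constant. The support is also bounded, so one power of `ℓ` serves for invariance
and support. -/
theorem IsStepFunction.exists_level {L : Submodule ℤ V} {b : Basis (Fin n) ℚ V}
    (hb : IsLatticeBasis L b) {F : LocalSpace ℓ V → ℤ} (hF : IsStepFunction ℓ F) :
    ∃ k : ℕ, (∀ x, ∀ y ∈ localLattice ℓ L, F (x + ((ℓ ^ k : ℕ) : ℚ_[ℓ]) • y) = F x) ∧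
      ∀ x, F x ≠ 0 → ((ℓ ^ k : ℕ) : ℚ_[ℓ]) • x ∈ localLattice ℓ L := by
  let e := localCoordinates ℓ b
  let F' : (Fin n → ℚ_[ℓ]) → ℤ := F ∘ e.symm
  have hF'c : Continuous F' := hF.1.continuous.comp e.symm.continuous
  have hF's : HasCompactSupport F' := hF.2.comp_homeomorph e.symm.toHomeomorph
  have huc := hF's.uniformContinuous_of_continuous hF'c
  obtain ⟨δ, hδ, huc⟩ := Metric.uniformContinuous_iff.1 huc 1 one_pos
  obtain ⟨R, hR⟩ := hF's.isCompact.isBounded.exists_norm_le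
  have hℓ : 1 < (ℓ : ℝ) := by exact_mod_cast (Fact.out : ℓ.Prime).one_lt
  have hnorm : ∀ k : ℕ, ‖((ℓ ^ k : ℕ) : ℚ_[ℓ])‖ = ((ℓ : ℝ) ^ k)⁻¹ := by
    intro k
    rw [Nat.cast_pow, norm_pow, Padic.norm_p, inv_pow]
  -- `R` bounds the support and `δ` is the modulus of continuity; `ℓ^k` must exceed both `R` and
  -- `δ⁻¹`.
  obtain ⟨k, hk⟩ := pow_unbounded_of_one_lt (max R δ⁻¹) hℓ
  have hk0 : (0 : ℝ) < (ℓ : ℝ) ^ k := by positivity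
  refine ⟨k, fun x y hy => ?_, fun x hx => ?_⟩
  · have h : dist (e (x + ((ℓ ^ k : ℕ) : ℚ_[ℓ]) • y)) (e x) < δ := by
      rw [map_add, dist_eq_norm, add_sub_cancel_left, map_smul, norm_smul, hnorm]
      calc _ ≤ ((ℓ : ℝ) ^ k)⁻¹ * 1 := by
            gcongr
            exact (hb.mem_localLattice_iff_norm_le ℓ y).1 hy
        _ < δ := by
            rw [mul_one]
            exact inv_lt_of_inv_lt₀ hδ ((le_max_right _ _).trans_lt hk)
    have := huc h
    simp only [F', Function.comp_apply, ContinuousLinearEquiv.symm_apply_apply] at this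
    rw [Int.dist_eq] at this
    have h2 : |F (x + ((ℓ ^ k : ℕ) : ℚ_[ℓ]) • y) - F x| < 1 := by exact_mod_cast this
    have := Int.abs_lt_one_iff.1 h2
    lia
  · rw [hb.mem_localLattice_iff_norm_le ℓ, map_smul, norm_smul, hnorm]
    have : ‖e x‖ ≤ R := hR _ (subset_tsupport _ (by simpa [F'] using hx))
    rw [inv_mul_le_iff₀ hk0, mul_one]
    exact (this.trans (le_max_left _ _)).trans hk.le

end StepFunctions

section TestFunctions

variable (p : ℕ) {V : Type u} [AddCommGroup V] [Module ℚ V] (L : Submodule ℤ V)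

/-- The points of `V` lying in `L_ℓ` for each prime `ℓ ≠ p`, i.e. `L ⊗ ℤ[1/p]`. -/
noncomputable def awayPoints : AddSubgroup V :=
  ⨅ ℓ : PrimesAway p, (localLattice ℓ.1 L).toAddSubgroup.comap (toLocal ℓ.1)

theorem mem_awayPoints {v : V} :
    v ∈ awayPoints p L ↔ ∀ ℓ : PrimesAway p, toLocal ℓ.1 v ∈ localLattice ℓ.1 L := by
  rw [awayPoints, AddSubgroup.mem_iInf]
  rfl

/-- `f` is invariant under `N L[1/p]` and supported in `N⁻¹ L[1/p]`. -/
structure HasLevelAway (N : ℕ) (f : V → ℤ) : Prop where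
  add_nsmul : ∀ v, ∀ y ∈ awayPoints p L, f (v + N • y) = f v
  nsmul_mem : ∀ v, f v ≠ 0 → N • v ∈ awayPoints p L

variable {p L} {n : ℕ} {b : Basis (Fin n) ℚ V}

theorem HasLevelAway.mul_right {N : ℕ} {f : V → ℤ} (h : HasLevelAway p L N f) (N' : ℕ) :
    HasLevelAway p L (N * N') f where
  add_nsmul v y hy := by
    rw [mul_nsmul']
    exact h.add_nsmul v _ (AddSubgroup.nsmul_mem _ hy N')
  nsmul_mem v hv := by
    rw [mul_nsmul]
    exact AddSubgroup.nsmul_mem _ (h.nsmul_mem v hv) N'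

theorem IsPureTensorAway.exists_hasLevelAway (hp : p.Prime) (hb : IsLatticeBasis L b) {f : V → ℤ}
    (hf : IsPureTensorAway p L f) : ∃ N : ℕ, ¬ p ∣ N ∧ HasLevelAway p L N f := by
  obtain ⟨F, hF, hfin, hf⟩ := hf
  -- Level exponent `0` is forced at the standard factors, so that the product of all `ℓ^k` is
  -- finite.
  have hlev : ∀ ℓ : PrimesAway p, ∃ k : ℕ,
      (F ℓ = latticeIndicator L ℓ.1 → k = 0) ∧
      (∀ x, ∀ y ∈ localLattice ℓ.1 L, F ℓ (x + ((ℓ.1 ^ k : ℕ) : ℚ_[ℓ.1]) • y) = F ℓ x) ∧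
      ∀ x, F ℓ x ≠ 0 → ((ℓ.1 ^ k : ℕ) : ℚ_[ℓ.1]) • x ∈ localLattice ℓ.1 L := by
    intro ℓ
    by_cases h : F ℓ = latticeIndicator L ℓ.1
    · refine ⟨0, fun _ => rfl, fun x y hy => ?_, fun x hx => ?_⟩
      · rw [h, pow_zero, Nat.cast_one, one_smul]
        have : x + y ∈ localLattice ℓ.1 L ↔ x ∈ localLattice ℓ.1 L :=
          (localLattice ℓ.1 L).add_mem_iff_left hy
        by_cases hx : x ∈ localLattice ℓ.1 L
        · rw [latticeIndicator, Set.indicator_of_mem hx, Set.indicator_of_mem (this.2 hx)]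
          rfl
        · rw [latticeIndicator, Set.indicator_of_notMem hx,
            Set.indicator_of_notMem fun h => hx (this.1 h)]
      · rw [pow_zero, Nat.cast_one, one_smul]
        rw [h] at hx
        exact Set.mem_of_indicator_ne_zero hx
    · obtain ⟨k, hk⟩ := (hF ℓ).exists_level ℓ.1 hb
      exact ⟨k, fun h' => absurd h' h, hk⟩
  choose k hk0 hk1 hk2 using hlev
  let N := ∏ ℓ ∈ hfin.toFinset, ℓ.1 ^ k ℓ
  have hdvd : ∀ ℓ : PrimesAway p, ℓ.1 ^ k ℓ ∣ N := by
    intro ℓ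
    by_cases h : F ℓ = latticeIndicator L ℓ.1
    · rw [hk0 ℓ h, pow_zero]
      exact one_dvd _
    · exact Finset.dvd_prod_of_mem (fun ℓ : PrimesAway p => ℓ.1 ^ k ℓ) (hfin.mem_toFinset.2 h)
  refine ⟨N, fun h => ?_, fun v y hy => ?_, fun v hv => ?_⟩
  · obtain ⟨ℓ, -, h⟩ := (Prime.dvd_finsetProd_iff hp.prime _).1 h
    exact ℓ.2.2 ((Nat.prime_dvd_prime_iff_eq hp ℓ.2.1).1 (hp.dvd_of_dvd_pow h)).symm
  · rw [hf, hf]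
    refine finprod_congr fun ℓ => ?_
    obtain ⟨c, hc⟩ := hdvd ℓ
    have : toLocal ℓ.1 (v + N • y) =
        toLocal ℓ.1 v + ((ℓ.1 ^ k ℓ : ℕ) : ℚ_[ℓ.1]) • (c • toLocal ℓ.1 y) := by
      rw [map_add, map_nsmul, hc, mul_nsmul', Nat.cast_smul_eq_nsmul]
    rw [this]
    exact hk1 ℓ _ _ (nsmul_mem ((mem_awayPoints p L).1 hy ℓ) c)
  · rw [mem_awayPoints]
    intro ℓ
    -- `finprod` takes the value `1` on an infinite multiplicative support, so finiteness is needed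
    -- before a zero factor can force `f v = 0`. If `d v ∈ L`, a standard factor at `ℓ ∤ d` equals
    -- `1`.
    have hfs : (Function.mulSupport fun ℓ : PrimesAway p => F ℓ (toLocal ℓ.1 v)).Finite := by
      obtain ⟨d, hd, hdv⟩ := hb.exists_nsmul_mem v
      have hfd : {ℓ : PrimesAway p | ℓ.1 ∣ d}.Finite := by
        refine Set.Finite.of_injOn (f := fun ℓ : PrimesAway p => ℓ.1) (t := (d.divisors : Set ℕ))
          (fun ℓ h => ?_) Subtype.val_injective.injOn (Finset.finite_toSet _)
        simpa [hd] using h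
      refine (hfin.union hfd).subset fun ℓ hℓ => ?_
      by_contra hn
      simp only [Set.mem_union, Set.mem_ofPred_eq, not_or, not_not] at hn
      refine hℓ ?_
      change F ℓ (toLocal ℓ.1 v) = 1
      rw [hn.1, latticeIndicator, Set.indicator_of_mem]
      · rfl
      · exact (hb.toLocal_nsmul_mem_iff ℓ.1 hn.2 v).1 (toLocal_mem_of_mem ℓ.1 hdv)
    have hne : F ℓ (toLocal ℓ.1 v) ≠ 0 := by
      intro h0
      rw [hf, finprod_eq_prod_of_mulSupport_subset _ hfs.coe_toFinset.ge] at hv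
      refine hv (Finset.prod_eq_zero (hfs.mem_toFinset.2 ?_) h0)
      rw [Function.mem_mulSupport, h0]
      exact zero_ne_one
    obtain ⟨c, hc⟩ := hdvd ℓ
    rw [map_nsmul, hc, mul_comm, mul_nsmul', ← Nat.cast_smul_eq_nsmul ℚ_[ℓ.1] (ℓ.1 ^ k ℓ)]
    exact nsmul_mem (hk2 ℓ _ hne) c

theorem exists_hasLevelAway (hp : p.Prime) (hb : IsLatticeBasis L b) {f : V → ℤ}
    (hf : f ∈ testFunctionsAway p L) : ∃ N : ℕ, ¬ p ∣ N ∧ HasLevelAway p L N f := by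
  induction hf using AddSubgroup.closure_induction with
  | mem f hf => exact hf.exists_hasLevelAway hp hb
  | zero => exact ⟨1, hp.one_lt.ne' ∘ Nat.dvd_one.1, fun _ _ _ => rfl, fun v hv => absurd rfl hv⟩
  | add f g _ _ hf hg =>
    obtain ⟨N, hN, hf⟩ := hf
    obtain ⟨N', hN', hg⟩ := hg
    have hf' := hf.mul_right N'
    have hg' := hg.mul_right N
    rw [mul_comm] at hg'
    refine ⟨N * N', fun h => (hp.dvd_mul.1 h).elim hN hN', fun v y hy => ?_, fun v hv => ?_⟩
    · rw [Pi.add_apply, Pi.add_apply, hf'.add_nsmul v y hy, hg'.add_nsmul v y hy]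
    · by_cases h : f v = 0
      · exact hg'.nsmul_mem v fun h' => hv (by rw [Pi.add_apply, h, h', add_zero])
      · exact hf'.nsmul_mem v h
  | neg f _ hf =>
    obtain ⟨N, hN, hf⟩ := hf
    exact ⟨N, hN, fun v y hy => congrArg Neg.neg (hf.add_nsmul v y hy),
      fun v hv => hf.nsmul_mem v fun h => hv (by rw [Pi.neg_apply, h, neg_zero])⟩

end TestFunctions

end PadicShintani

/-! ### From Haar measure zero to vanishing sums along progressions -/

section PeriodicSums

open Finset

theorem Function.Periodic.sum_range_mul {A : Type*} [AddCommMonoid A] {h : ℕ → A} {M : ℕ}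
    (hh : Function.Periodic h M) (N : ℕ) :
    ∑ j ∈ range (M * N), h j = N • ∑ j ∈ range M, h j := by
  induction N with
  | zero => simp
  | succ N ih =>
    rw [mul_add, mul_one, sum_range_add, ih, succ_nsmul]
    congr 1
    refine sum_congr rfl fun j _ => ?_
    rw [add_comm, mul_comm]
    exact hh.nat_mul N j

/-- Multiplication by `c` permutes the residues modulo `M`. -/
theorem Function.Periodic.sum_range_comp_mul {A : Type*} [AddCommMonoid A] {h : ℕ → A} {M c : ℕ}
    (hh : Function.Periodic h M) (hc : c.Coprime M) :
    ∑ j ∈ range M, h (c * j) = ∑ j ∈ range M, h j := by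
  have hinj : Set.InjOn (fun j => c * j % M) (range M : Set ℕ) := by
    intro i hi j hj hij
    have h1 : i ≡ j [MOD M] := Nat.ModEq.cancel_left_of_coprime hc.symm hij
    exact h1.eq_of_lt_of_lt (mem_range.1 hi) (mem_range.1 hj)
  have himg : (range M).image (fun j => c * j % M) = range M := by
    refine eq_of_subset_of_card_le (fun x hx => ?_) (card_image_of_injOn hinj).ge
    obtain ⟨j, hj, rfl⟩ := mem_image.1 hx
    exact mem_range.2 (Nat.mod_lt _ (Nat.zero_lt_of_lt (mem_range.1 hj)))
  conv_rhs => rw [← himg]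
  rw [sum_image hinj]
  exact sum_congr rfl fun j _ => (hh.map_mod_nat _).symm

end PeriodicSums

namespace PadicShintani

universe u

section Haar

/-- The support of `g` lies in `m⁻¹ℤ`, whose classes modulo `Kℤ` are represented once each by `j /
m` with `0 ≤ j < m K`. `K` is the least period occurring in `haarRat`. -/
theorem exists_sum_eq_zero_of_haarRat_eq_zero {g : ℚ → ℤ} {m : ℕ} (hm : m ≠ 0)
    (hper : ∃ K : ℕ, 0 < K ∧ Function.Periodic g (K : ℚ))
    (hsupp : ∀ x, g x ≠ 0 → ∃ z : ℤ, (m : ℚ) * x = z) (hg : haarRat g = 0) :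
    ∃ K : ℕ, 0 < K ∧ Function.Periodic g (K : ℚ) ∧
      ∑ j ∈ Finset.range (m * K), g ((j : ℚ) / m) = 0 := by
  classical
  rw [haarRat, dif_pos hper] at hg
  generalize_proofs h1 at hg
  have hK := (Nat.find_spec hper).1
  have hP := (Nat.find_spec hper).2
  refine ⟨Nat.find hper, hK, hP, ?_⟩
  generalize Nat.find hper = K at *
  have hmQ : (m : ℚ) ≠ 0 := Nat.cast_ne_zero.2 hm
  have hKQ : (K : ℚ) ≠ 0 := Nat.cast_ne_zero.2 hK.ne'
  have hmK : (0 : ℤ) < ((m * K : ℕ) : ℤ) := by positivity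
  replace hg := (mul_eq_zero.1 hg).resolve_left (inv_ne_zero hKQ)
  let q : ℕ → ℚ ⧸ AddSubgroup.zmultiples (K : ℚ) := fun j => (((j : ℚ) / m : ℚ) : ℚ ⧸ _)
  have hq : ∀ (x : ℚ) (j : ℕ), ((x : ℚ) : ℚ ⧸ AddSubgroup.zmultiples (K : ℚ)) = q j ↔
      ∃ k : ℤ, (j : ℚ) = m * x + k * (m * K : ℕ) := by
    intro x j
    rw [QuotientAddGroup.eq, AddSubgroup.mem_zmultiples_iff]
    refine exists_congr fun k => ?_
    rw [zsmul_eq_mul, neg_add_eq_sub, eq_sub_iff_add_eq, eq_div_iff hmQ]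
    push_cast
    constructor <;> intro h <;> linarith
  have hinj : Set.InjOn q (Finset.range (m * K) : Set ℕ) := by
    intro i hi j hj hij
    obtain ⟨k, hk⟩ := (hq _ j).1 hij
    rw [mul_div_cancel₀ _ hmQ] at hk
    have hk' : (j : ℤ) = i + k * (m * K : ℕ) := by exact_mod_cast hk
    have := congrArg (· % ((m * K : ℕ) : ℤ)) hk'
    simp only [Int.add_mul_emod_self_right] at this
    have hi := Finset.mem_range.1 hi
    have hj := Finset.mem_range.1 hj
    rw [Int.emod_eq_of_lt (by positivity) (by exact_mod_cast hj),
      Int.emod_eq_of_lt (by positivity) (by exact_mod_cast hi)] at this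
    exact_mod_cast this.symm
  rw [finsum_eq_sum_of_support_subset (s := (Finset.range (m * K)).image q), Finset.sum_image hinj]
    at hg
  · rw [← Int.cast_sum] at hg
    exact Int.cast_eq_zero.1 hg
  · intro x hx
    induction x using QuotientAddGroup.induction_on with
    | H x =>
      have hx : g x ≠ 0 := fun h => hx (Int.cast_eq_zero.2 h)
      obtain ⟨z, hz⟩ := hsupp x hx
      rw [Finset.coe_image]
      refine ⟨(z % (m * K : ℕ)).toNat, ?_, Eq.symm ((hq _ _).2 ⟨-(z / (m * K : ℕ)), ?_⟩)⟩
      · refine Finset.mem_coe.2 (Finset.mem_range.2 ?_)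
        have := Int.emod_lt_of_pos z hmK
        have := Int.emod_nonneg z hmK.ne'
        lia
      · have h2 : (((z % (m * K : ℕ)).toNat : ℕ) : ℤ) = z + -(z / (m * K : ℕ)) * (m * K : ℕ) := by
          rw [Int.toNat_of_nonneg (Int.emod_nonneg z hmK.ne'), Int.emod_def]
          ring
        rw [hz]
        exact_mod_cast h2

end Haar

section Vanishing

open Module

variable {p : ℕ} [Fact p.Prime] {V : Type u} [AddCommGroup V] [Module ℚ V] {L : Submodule ℤ V}
  {n : ℕ} {b : Basis (Fin n) ℚ V}

theorem not_dvd_of_primesAway (ℓ : PrimesAway p) (a : ℕ) : ¬ ℓ.1 ∣ p ^ a := fun h =>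
  ℓ.2.2 ((Nat.prime_dvd_prime_iff_eq ℓ.2.1 Fact.out).1 (ℓ.2.1.dvd_of_dvd_pow h))

/-- The `p`-part of a common denominator is a unit at every other prime and may be dropped. -/
theorem IsLatticeBasis.exists_nsmul_mem_awayPoints (hb : IsLatticeBasis L b) (w : V) :
    ∃ d : ℕ, ¬ p ∣ d ∧ d • w ∈ awayPoints p L := by
  obtain ⟨d, hd, hdw⟩ := hb.exists_nsmul_mem w
  obtain ⟨e, d', hd', rfl⟩ := Nat.exists_eq_pow_mul_and_not_dvd hd p
    (Fact.out : p.Prime).ne_one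
  refine ⟨d', hd', (mem_awayPoints p L).2 fun ℓ => ?_⟩
  rw [← hb.toLocal_nsmul_mem_iff ℓ.1 (not_dvd_of_primesAway ℓ e), ← mul_nsmul']
  exact toLocal_mem_of_mem ℓ.1 hdw

theorem IsLatticeBasis.exists_pow_nsmul_mem_integralPoints (hb : IsLatticeBasis L b) (w : V) :
    ∃ a : ℕ, p ^ a • w ∈ integralPoints p L := by
  obtain ⟨d, hd, hdw⟩ := hb.exists_nsmul_mem w
  obtain ⟨e, d', hd', rfl⟩ := Nat.exists_eq_pow_mul_and_not_dvd hd p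
    (Fact.out : p.Prime).ne_one
  refine ⟨e, ?_⟩
  change toLocal p _ ∈ localLattice p L
  rw [← hb.toLocal_nsmul_mem_iff p hd', ← mul_nsmul', mul_comm]
  exact toLocal_mem_of_mem p hdw

/-- The rational multiples `x w` with `x` integral at `p` and `N x w ∈ L[1/p]` have bounded
denominators, prime to `p`. -/
theorem IsLatticeBasis.exists_denominator (hb : IsLatticeBasis L b) {N : ℕ} (hN : ¬ p ∣ N) {w : V}
    (hw : w ≠ 0) : ∃ m : ℕ, ¬ p ∣ m ∧ ∀ x : ℚ, ‖(x : ℚ_[p])‖ ≤ 1 →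
      N • (x • w) ∈ awayPoints p L → ∃ z : ℤ, (m : ℚ) * x = z := by
  obtain ⟨k, hk⟩ : ∃ k, b.repr w k ≠ 0 := by
    by_contra! h
    exact hw (b.repr.map_eq_zero_iff.1 (Finsupp.ext h))
  set c := b.repr w k with hc
  have hp : p.Prime := Fact.out
  -- `c` is a nonzero coordinate of `w`, so `N x c` is integral at every `ℓ ≠ p`. Its numerator
  -- gives the bound on denominators; the `p`-part is removed because it is a unit at `ℓ` and would
  -- spoil `p ∤ m`.
  obtain ⟨e, c', hc', hce⟩ := Nat.exists_eq_pow_mul_and_not_dvd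
    (Int.natAbs_ne_zero.2 (Rat.num_ne_zero.2 hk)) p hp.ne_one
  refine ⟨N * c', fun h => (hp.dvd_mul.1 h).elim hN hc', fun x hx hxw => ?_⟩
  suffices ∃ z : ℤ, ((N * c' : ℕ) : ℚ) * x = z from this
  refine Rat.exists_eq_intCast_of_forall_padic_norm_le_one fun ℓ hℓ => ?_
  push_cast
  by_cases hlp : ℓ = p
  · subst hlp
    rw [norm_mul, norm_mul]
    exact mul_le_one₀ (mul_le_one₀ (Padic.norm_int_le_one N) (norm_nonneg _)
      (Padic.norm_int_le_one c')) (norm_nonneg _) hx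
  · have h1 := (hb.toLocal_mem_iff ℓ _).1 ((mem_awayPoints p L).1 hxw ⟨ℓ, hℓ.out, hlp⟩) k
    rw [map_nsmul, Finsupp.smul_apply, map_smul, Finsupp.smul_apply, ← hc, nsmul_eq_mul,
      smul_eq_mul] at h1
    push_cast at h1
    have h2 : ‖((p : ℕ) : ℚ_[ℓ])‖ = 1 := Padic.norm_natCast_eq_one_of_not_dvd fun h =>
      hlp ((Nat.prime_dvd_prime_iff_eq hℓ.out hp).1 h)
    have h3 : ‖(c' : ℚ_[ℓ])‖ = ‖(c : ℚ_[ℓ])‖ * ‖(c.den : ℚ_[ℓ])‖ := by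
      have h4 : ‖((c.num.natAbs : ℕ) : ℚ_[ℓ])‖ = ‖(c' : ℚ_[ℓ])‖ := by
        rw [hce]
        push_cast
        rw [norm_mul, norm_pow, h2, one_pow, one_mul]
      have h5 : (c : ℚ_[ℓ]) * (c.den : ℚ_[ℓ]) = (c.num : ℚ_[ℓ]) := by
        exact_mod_cast Rat.mul_den_eq_num c
      rw [← h4, ← norm_mul, h5]
      rcases Int.natAbs_eq c.num with h | h
      · conv_rhs => rw [h, Int.cast_natCast]
      · conv_rhs => rw [h, Int.cast_neg, Int.cast_natCast, norm_neg]
    calc ‖(N : ℚ_[ℓ]) * c' * x‖ = ‖(N : ℚ_[ℓ]) * (x * c)‖ * ‖(c.den : ℚ_[ℓ])‖ := by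
          simp only [norm_mul, h3]
          ring
      _ ≤ 1 := mul_le_one₀ h1 (norm_nonneg _) (Padic.norm_int_le_one c.den)

/-- The part of the line `v + ℚ w` seen by the Haar measure away from `p` is one progression with
step `w / m`, where `m` does not depend on `v`. If `d w ∈ L[1/p]`, then `N d w` is a period of `f`,
so `M = m N d` is a period along the progression, and it is prime to `p`. -/
theorem VanishingHypothesis.exists_sum_eq_zero (hb : IsLatticeBasis L b) {N : ℕ} (hN : ¬ p ∣ N)
    {f : V → ℤ} (hf : HasLevelAway p L N f) {w : V} (hw : w ≠ 0)
    (hv : VanishingHypothesis p f w) :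
    ∃ m M : ℕ, m ≠ 0 ∧ ¬ p ∣ M ∧ ∀ v, Function.Periodic
      (fun j : ℕ => f (v + j • ((m : ℚ)⁻¹ • w))) M ∧
      ∑ j ∈ Finset.range M, f (v + j • ((m : ℚ)⁻¹ • w)) = 0 := by
  have hp : p.Prime := Fact.out
  obtain ⟨d, hd, hdw⟩ := hb.exists_nsmul_mem_awayPoints (p := p) w
  obtain ⟨m, hm, hden⟩ := hb.exists_denominator hN hw
  have hm0 : m ≠ 0 := fun h => hm (h ▸ dvd_zero p)
  have hNd : ¬ p ∣ N * d := fun h => (hp.dvd_mul.1 h).elim hN hd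
  have hNd0 : N * d ≠ 0 := fun h => hNd (h ▸ dvd_zero p)
  have hmQ : (m : ℚ) ≠ 0 := Nat.cast_ne_zero.2 hm0
  have hu : ∀ j : ℕ, j • ((m : ℚ)⁻¹ • w) = ((j : ℚ) / m) • w := fun j => by
    rw [← Nat.cast_smul_eq_nsmul ℚ, smul_smul, div_eq_mul_inv]
  have hshift : ∀ v, f (v + ((N * d : ℕ) : ℚ) • w) = f v := fun v => by
    rw [Nat.cast_smul_eq_nsmul, mul_nsmul']
    exact hf.add_nsmul v _ hdw
  have hint : ∀ j : ℕ, ‖(((j : ℚ) / m : ℚ) : ℚ_[p])‖ ≤ 1 := fun j => by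
    push_cast
    rw [norm_div, Padic.norm_natCast_eq_one_of_not_dvd hm, div_one]
    exact Padic.norm_int_le_one j
  refine ⟨m, m * (N * d), hm0, fun h => (hp.dvd_mul.1 h).elim hm hNd, fun v => ?_⟩
  have hper : Function.Periodic (fun j : ℕ => f (v + j • ((m : ℚ)⁻¹ • w))) (m * (N * d)) := by
    intro j
    change f (v + (j + m * (N * d)) • _) = f (v + j • _)
    rw [hu, hu, ← hshift (v + ((j : ℚ) / m) • w), add_assoc, ← add_smul]
    congr 3
    push_cast
    field_simp
  refine ⟨hper, ?_⟩
  -- As `v` is arbitrary, only differences of support points on the line have controlled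
  -- denominators. A support point `j₀ / m` on the grid serves as anchor and puts the whole support
  -- on the grid.
  by_cases hz : ∀ j : ℕ, f (v + j • ((m : ℚ)⁻¹ • w)) = 0
  · exact Finset.sum_eq_zero fun j _ => hz j
  push Not at hz
  obtain ⟨j₀, hj₀⟩ := hz
  rw [hu] at hj₀
  classical
  let g : ℚ → ℤ := fun x => if ‖(x : ℚ_[p])‖ ≤ 1 then f (v + x • w) else 0
  have hg0 : haarRat g = 0 := by
    have := hv v
    rw [haarAway] at this
    convert this
  have hgK : Function.Periodic g ((N * d : ℕ) : ℚ) := by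
    intro x
    have h1 : ‖((x + ((N * d : ℕ) : ℚ) : ℚ) : ℚ_[p])‖ ≤ 1 ↔ ‖(x : ℚ_[p])‖ ≤ 1 := by
      rw [Rat.cast_add, Rat.cast_natCast]
      exact add_mem_cancel_right (H := PadicInt.subring p)
        (Padic.norm_int_le_one ((N * d : ℕ) : ℤ))
    change (if _ then _ else _) = if _ then _ else _
    simp only [h1, add_smul, ← add_assoc, hshift]
  have hgs : ∀ x, g x ≠ 0 → ∃ z : ℤ, (m : ℚ) * x = z := by
    intro x hx
    have hx1 : ‖(x : ℚ_[p])‖ ≤ 1 := by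
      by_contra h
      exact hx (if_neg h)
    have hx2 : f (v + x • w) ≠ 0 := by
      have : g x = f (v + x • w) := if_pos hx1
      rwa [this] at hx
    obtain ⟨z, hz⟩ := hden (x - (j₀ : ℚ) / m) (by
      rw [Rat.cast_sub]
      exact (PadicInt.subring p).sub_mem hx1 (hint j₀)) (by
      have := sub_mem (hf.nsmul_mem _ hx2) (hf.nsmul_mem _ hj₀)
      rwa [← nsmul_sub, add_sub_add_left_eq_sub, ← sub_smul] at this)
    refine ⟨z + j₀, ?_⟩
    rw [mul_sub, mul_div_cancel₀ _ hmQ] at hz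
    push_cast
    linarith
  obtain ⟨K, hK, hKper, hsum⟩ := exists_sum_eq_zero_of_haarRat_eq_zero hm0
    ⟨N * d, Nat.pos_of_ne_zero hNd0, hgK⟩ hgs hg0
  have hgf : ∀ j : ℕ, g ((j : ℚ) / m) = f (v + j • ((m : ℚ)⁻¹ • w)) := fun j => by
    rw [hu]
    exact if_pos (hint j)
  simp only [hgf] at hsum
  have hper' : Function.Periodic (fun j : ℕ => f (v + j • ((m : ℚ)⁻¹ • w))) (m * K) := by
    intro j
    simp only [← hgf]
    rw [← hKper ((j : ℚ) / m)]
    congr 1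
    push_cast
    field_simp
  -- The least period used by `haarRat` need not be `N d`; the two sums are compared over a common
  -- multiple of both periods.
  have h1 := hper.sum_range_mul (m * K)
  have h2 := hper'.sum_range_mul (m * (N * d))
  rw [mul_comm, h2, hsum, smul_zero] at h1
  exact (smul_eq_zero.1 h1.symm).resolve_left (mul_ne_zero hm0 hK.ne')

/-- A ray for which the vanishing hypothesis holds is generated by a `p`-integral vector `u` such
that the sums of `f` over progressions `v, v + u, …, v + (M - 1) u` vanish for some `M` prime
to `p`. -/
theorem VanishingHypothesis.exists_integralPoint (hb : IsLatticeBasis L b) {N : ℕ}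
    (hN : ¬ p ∣ N) {f : V → ℤ} (hf : HasLevelAway p L N f) {w : V} (hw : w ≠ 0)
    (hv : VanishingHypothesis p f w) :
    ∃ (q : ℚ) (M : ℕ), 0 < q ∧ ¬ p ∣ M ∧ q • w ∈ integralPoints p L ∧
      ∀ v, ∑ j ∈ Finset.range M, f (v + j • (q • w)) = 0 := by
  have hp : p.Prime := Fact.out
  obtain ⟨m, M, hm, hM, h⟩ := hv.exists_sum_eq_zero hb hN hf hw
  obtain ⟨a, ha⟩ := hb.exists_pow_nsmul_mem_integralPoints (p := p) ((m : ℚ)⁻¹ • w)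
  have hq : ((p ^ a : ℕ) * (m : ℚ)⁻¹) • w = p ^ a • ((m : ℚ)⁻¹ • w) := by
    rw [mul_smul, Nat.cast_smul_eq_nsmul]
  refine ⟨(p ^ a : ℕ) * (m : ℚ)⁻¹, M, ?_, hM, hq ▸ ha, fun v => ?_⟩
  · have := hp.pos
    positivity
  -- Scaling the step by `p^a`, which makes it integral at `p`, only permutes the residues modulo
  -- `M`, since `p ∤ M`.
  · rw [← (h v).2, ← (h v).1.sum_range_comp_mul
      (((Nat.Prime.coprime_iff_not_dvd hp).2 hM).pow_left a), hq]
    refine Finset.sum_congr rfl fun j _ => ?_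
    rw [smul_smul, mul_comm]

end Vanishing

end PadicShintani

namespace PadicShintani

universe u

open Module

/-! ### Geometric sums acting on formal series -/

section GeometricSums

variable {p : ℕ} [Fact p.Prime] {V : Type u} [AddCommGroup V] [Module ℚ V] {L : Submodule ℤ V}

/-- The Laurent polynomial `1 + q^u + ⋯ + q^((M - 1) u)`. -/
noncomputable def geomLaurent (u : integralPoints p L) (M : ℕ) :
    AddMonoidAlgebra ℤ (integralPoints p L) :=
  ∑ j ∈ Finset.range M, AddMonoidAlgebra.single u 1 ^ j

theorem laurentMul_geomLaurent (u : integralPoints p L) (M : ℕ) (s : integralPoints p L → ℤ)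
    (v : integralPoints p L) :
    laurentMul (geomLaurent u M) s v = ∑ j ∈ Finset.range M, s (v - j • u) := by
  rw [geomLaurent, laurentMul_sum]
  refine Finset.sum_congr rfl fun j _ => ?_
  rw [AddMonoidAlgebra.single_pow, one_pow, laurentMul_single]
  exact one_mul _

theorem one_sub_mul_geomLaurent (u : integralPoints p L) (M : ℕ) :
    (1 - AddMonoidAlgebra.single u 1) * geomLaurent u M =
      1 - AddMonoidAlgebra.single (M • u) 1 := by
  rw [geomLaurent, mul_neg_geom_sum, AddMonoidAlgebra.single_pow, one_pow]

theorem mem_of_laurentMul_geomLaurent_ne_zero {u : integralPoints p L} {M : ℕ}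
    {s : integralPoints p L → ℤ} {X : Set (integralPoints p L)} (hX : ∀ x ∈ X, x + u ∈ X)
    (hs : ∀ v, s v ≠ 0 → v ∈ X) {v : integralPoints p L}
    (hv : laurentMul (geomLaurent u M) s v ≠ 0) : v ∈ X := by
  rw [laurentMul_geomLaurent] at hv
  obtain ⟨j, -, hj⟩ := Finset.exists_ne_zero_of_sum_ne_zero hv
  have hadd : ∀ (i : ℕ), ∀ x ∈ X, x + i • u ∈ X := by
    intro i
    induction i with
    | zero => simp
    | succ i ih =>
      intro x hx
      rw [succ_nsmul, ← add_assoc]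
      exact hX _ (ih x hx)
  simpa using hadd j _ (hs _ hj)

/-- Multiplication by these factors only moves the support along the `u i`, so any set stable under
those translations still contains it. -/
theorem mem_of_laurentMul_prod_geomLaurent_ne_zero {ι : Type*} {u : ι → integralPoints p L}
    {M : ι → ℕ} {s : integralPoints p L → ℤ} {X : Set (integralPoints p L)} (T : Finset ι)
    (hX : ∀ i ∈ T, ∀ x ∈ X, x + u i ∈ X) (hs : ∀ v, s v ≠ 0 → v ∈ X) {v : integralPoints p L}
    (hv : laurentMul (∏ i ∈ T, geomLaurent (u i) (M i)) s v ≠ 0) : v ∈ X := by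
  classical
  induction T using Finset.induction_on generalizing v with
  | empty => exact hs v (by rwa [Finset.prod_empty, laurentMul_one] at hv)
  | insert i T hi ih =>
    rw [Finset.prod_insert hi, laurentMul_mul] at hv
    exact mem_of_laurentMul_geomLaurent_ne_zero (hX i (Finset.mem_insert_self i T))
      (fun _ h => ih (fun j hj => hX j (Finset.mem_insert_of_mem hj)) h) hv

end GeometricSums

/-! ### Coordinates on open cones -/

section OpenCones

variable {V : Type u} [AddCommGroup V] [Module ℚ V]

theorem toReal_smul (q : ℚ) (v : V) : toReal (q • v) = (q : ℝ) • toReal v := by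
  change (1 : ℝ) ⊗ₜ[ℚ] (q • v) = (q : ℝ) • ((1 : ℝ) ⊗ₜ[ℚ] v)
  rw [TensorProduct.tmul_smul, TensorProduct.smul_tmul', TensorProduct.smul_tmul',
    Rat.smul_def, smul_eq_mul]

theorem openCone_smul {ι : Type*} [Fintype ι] (w : ι → V) {q : ι → ℚ} (hq : ∀ i, 0 < q i) :
    openCone (fun i => q i • w i) = openCone w := by
  ext x
  constructor
  · rintro ⟨a, ha, rfl⟩
    refine ⟨fun i => a i * q i, fun i => mul_pos (ha i) (Rat.cast_pos.2 (hq i)), ?_⟩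
    simp only [toReal_smul, smul_smul]
  · rintro ⟨a, ha, rfl⟩
    refine ⟨fun i => a i / q i, fun i => div_pos (ha i) (Rat.cast_pos.2 (hq i)), ?_⟩
    refine Finset.sum_congr rfl fun i _ => ?_
    rw [toReal_smul, smul_smul, div_mul_cancel₀ _ (Rat.cast_ne_zero.2 (hq i).ne')]

/-- Linear functionals dual to a linearly independent family. -/
theorem exists_dual_of_linearIndependent {ι E : Type*} [AddCommGroup E] [Module ℝ E] {t : ι → E}
    (ht : LinearIndependent ℝ t) :
    ∃ g : E →ₗ[ℝ] ι →₀ ℝ, ∀ i, g (t i) = Finsupp.single i 1 := by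
  obtain ⟨g, hg⟩ := LinearMap.exists_extend ht.repr
  refine ⟨g, fun i => ?_⟩
  have hi : t i ∈ Submodule.span ℝ (Set.range t) := Submodule.subset_span ⟨i, rfl⟩
  have := LinearMap.congr_fun hg ⟨t i, hi⟩
  rw [LinearMap.comp_apply, ht.repr_eq_single i _ rfl] at this
  exact this

theorem eq_sum_of_mem_span {ι E : Type*} [Fintype ι] [AddCommGroup E] [Module ℝ E] {t : ι → E}
    {g : E →ₗ[ℝ] ι →₀ ℝ} (hg : ∀ i, g (t i) = Finsupp.single i 1) {x : E}
    (hx : x ∈ Submodule.span ℝ (Set.range t)) : x = ∑ i, g x i • t i := by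
  obtain ⟨c, rfl⟩ := (Submodule.mem_span_range_iff_exists_fun ℝ).1 hx
  refine Finset.sum_congr rfl fun i _ => ?_
  congr 1
  classical
  simp [hg, Finsupp.single_apply]

/-- The functionals `g` are extended to all of `V_ℝ` and read coordinates correctly only on the
span, hence the separate span condition. -/
theorem mem_openCone_iff {ι : Type*} [Fintype ι] {w : ι → V}
    {g : RealSpace V →ₗ[ℝ] ι →₀ ℝ} (hg : ∀ i, g (toReal (w i)) = Finsupp.single i 1)
    (x : RealSpace V) : x ∈ openCone w ↔
      x ∈ Submodule.span ℝ (Set.range fun i => toReal (w i)) ∧ ∀ i, 0 < g x i := by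
  constructor
  · rintro ⟨a, ha, rfl⟩
    refine ⟨Submodule.sum_mem _ fun i _ => Submodule.smul_mem _ _ (Submodule.subset_span ⟨i, rfl⟩),
      fun i => ?_⟩
    classical
    simpa [hg, Finsupp.single_apply] using ha i
  · rintro ⟨hx, h⟩
    exact ⟨fun i => g x i, h, eq_sum_of_mem_span hg hx⟩

/-- A bounded subset of the span of `w` contains only finitely many points of `R⁻¹ L`. -/
theorem IsLatticeBasis.finite_of_bounded {L : Submodule ℤ V} {n : ℕ} {b : Basis (Fin n) ℚ V}
    (hb : IsLatticeBasis L b) {ι : Type*} [Fintype ι] {w : ι → V}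
    {g : RealSpace V →ₗ[ℝ] ι →₀ ℝ} (hg : ∀ i, g (toReal (w i)) = Finsupp.single i 1)
    {R : ℕ} (hR : R ≠ 0) (M : ι → ℕ) :
    {v : V | R • v ∈ L ∧ toReal v ∈ Submodule.span ℝ (Set.range fun i => toReal (w i)) ∧
      ∀ i, 0 ≤ g (toReal v) i ∧ g (toReal v) i ≤ M i}.Finite := by
  let bR : Basis (Fin n) ℝ (RealSpace V) := Algebra.TensorProduct.basis ℝ b
  have hbR : ∀ v k, bR.repr (toReal v) k = ((b.repr v k : ℚ) : ℝ) := by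
    intro v k
    refine (DFunLike.congr_fun (Algebra.TensorProduct.basis_repr_tmul b (1 : ℝ) v) k).trans ?_
    simp
  -- A bound for the `k`-th lattice coordinate of `R v`, obtained by writing `v` as a combination of
  -- the `w i` with coefficients in `[0, M i]`.
  let B : Fin n → ℤ := fun k => ⌈(R : ℝ) * ∑ i, M i * |((b.repr (w i) k : ℚ) : ℝ)|⌉
  refine Set.Finite.of_injOn (f := fun v k => (b.repr (R • v) k).num) (t := Set.Icc (-B) B)
    ?_ ?_ (Set.finite_Icc _ _)
  · rintro v ⟨hv, hvs, hg'⟩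
    have key : ∀ k, |(b.repr (R • v) k).num| ≤ B k := by
      intro k
      obtain ⟨z, hz⟩ := (hb _).1 hv k
      rw [hz, Rat.num_intCast]
      have h1 : (z : ℝ) = R * ∑ i, g (toReal v) i * ((b.repr (w i) k : ℚ) : ℝ) := by
        have h2 : ((b.repr v k : ℚ) : ℝ) = ∑ i, g (toReal v) i * ((b.repr (w i) k : ℚ) : ℝ) := by
          rw [← hbR]
          conv_lhs => rw [eq_sum_of_mem_span hg hvs]
          simp [hbR, Finsupp.finsetSum_apply]
        rw [← h2]
        rw [map_nsmul, Finsupp.smul_apply, nsmul_eq_mul] at hz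
        exact_mod_cast hz.symm
      have h3 : |(z : ℝ)| ≤ R * ∑ i, M i * |((b.repr (w i) k : ℚ) : ℝ)| := by
        rw [h1, abs_mul, Nat.abs_cast]
        gcongr
        refine (Finset.abs_sum_le_sum_abs _ _).trans (Finset.sum_le_sum fun i _ => ?_)
        rw [abs_mul, abs_of_nonneg (hg' i).1]
        gcongr
        exact (hg' i).2
      have h4 := h3.trans (Int.le_ceil _)
      change _ ≤ ⌈(R : ℝ) * ∑ i, M i * |((b.repr (w i) k : ℚ) : ℝ)|⌉
      exact_mod_cast h4
    exact ⟨fun k => (abs_le.1 (key k)).1, fun k => (abs_le.1 (key k)).2⟩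
  · rintro v ⟨hv, -⟩ v' ⟨hv', -⟩ h
    have hRv : R • v = R • v' := by
      refine b.repr.injective (Finsupp.ext fun k => ?_)
      obtain ⟨z, hz⟩ := (hb _).1 hv k
      obtain ⟨z', hz'⟩ := (hb _).1 hv' k
      have := congrFun h k
      simp only [hz, hz', Rat.num_intCast] at this
      rw [hz, hz', this]
    rw [← Nat.cast_smul_eq_nsmul ℚ, ← Nat.cast_smul_eq_nsmul ℚ] at hRv
    exact smul_right_injective V (Nat.cast_ne_zero.2 hR) hRv

end OpenCones

/-! ### Cone series as measures -/

section Main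

variable {p : ℕ} [Fact p.Prime] {V : Type u} [AddCommGroup V] [Module ℚ V] {L : Submodule ℤ V}
  {n : ℕ} {b : Basis (Fin n) ℚ V}

theorem IsLatticeBasis.mem_of_mem_away_of_mem_integral (hb : IsLatticeBasis L b) {v : V}
    (h : v ∈ awayPoints p L) (h' : v ∈ integralPoints p L) : v ∈ L := by
  refine hb.mem_of_forall_toLocal_mem fun ℓ hℓ => ?_
  by_cases hlp : ℓ = p
  · subst hlp
    exact h'
  · exact (mem_awayPoints p L).1 h ⟨ℓ, hℓ.out, hlp⟩

/-- The series of an open cone becomes a finite sum after multiplication by suitable geometric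
sums. -/
theorem finite_support_laurentMul_coneSeries (hb : IsLatticeBasis L b) {N : ℕ} (hN : N ≠ 0)
    {f : V → ℤ} (hf : HasLevelAway p L N f) {ι : Type*} [Fintype ι] (u : ι → integralPoints p L)
    (hu : LinearIndependent ℝ fun i => toReal (u i : V)) (M : ι → ℕ)
    (hM : ∀ i, ∀ v, ∑ j ∈ Finset.range (M i), f (v + j • (u i : V)) = 0) :
    (Function.support (laurentMul (∏ i, geomLaurent (u i) (M i))
      (coneSeries p L f (openCone fun i => (u i : V))))).Finite := by
  classical
  obtain ⟨g, hg⟩ := exists_dual_of_linearIndependent hu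
  have hcone := mem_openCone_iff (w := fun i => (u i : V)) hg
  set s := coneSeries p L f (openCone fun i => (u i : V)) with hs
  choose R hR0 hR using fun i => hb.exists_nsmul_mem (u i : V)
  -- `N` clears the denominators of the support of `f` and `R i` those of `u i`, so the lattice
  -- `R'⁻¹ L` is stable under all the shifts.
  let R' := N * ∏ i, R i
  have hR'0 : R' ≠ 0 := mul_ne_zero hN (Finset.prod_ne_zero_iff.2 fun i _ => hR0 i)
  have hR' : ∀ i, R' • (u i : V) ∈ L := by
    intro i
    obtain ⟨c, hc⟩ := (Finset.dvd_prod_of_mem R (Finset.mem_univ i)).mul_left N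
    change (N * ∏ i, R i) • (u i : V) ∈ L
    rw [hc, mul_nsmul]
    exact nsmul_mem (hR i) c
  have hg_shift : ∀ (x : integralPoints p L) (i k : ι),
      g (toReal ((x + u k : integralPoints p L) : V)) i =
      g (toReal (x : V)) i + if k = i then 1 else 0 := by
    intro x i k
    rw [AddSubgroup.coe_add, map_add, map_add, hg, Finsupp.add_apply, Finsupp.single_apply]
  have hg_sub : ∀ (x : integralPoints p L) (i k : ι) (j : ℕ),
      g (toReal ((x - j • u k : integralPoints p L) : V)) i =
      g (toReal (x : V)) i - if k = i then (j : ℝ) else 0 := by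
    intro x i k j
    rw [AddSubgroup.coe_sub, AddSubgroup.coe_nsmul, map_sub, map_sub, map_nsmul, map_nsmul, hg,
      Finsupp.sub_apply, Finsupp.smul_apply, Finsupp.single_apply]
    simp
  set W := Submodule.span ℝ (Set.range fun i => toReal (u i : V)) with hW
  have huW : ∀ i, toReal (u i : V) ∈ W := fun i => Submodule.subset_span ⟨i, rfl⟩
  let X : Set (integralPoints p L) := {v | R' • (v : V) ∈ L ∧ toReal (v : V) ∈ W ∧
    ∀ i, 0 ≤ g (toReal (v : V)) i}
  have hX : ∀ v, laurentMul (∏ i, geomLaurent (u i) (M i)) s v ≠ 0 → v ∈ X := by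
    intro v hv
    refine mem_of_laurentMul_prod_geomLaurent_ne_zero Finset.univ ?_ ?_ hv
    · rintro k - x ⟨h1, h2, h3⟩
      refine ⟨?_, ?_, fun i => ?_⟩
      · rw [AddSubgroup.coe_add, nsmul_add]
        exact add_mem h1 (hR' k)
      · rw [AddSubgroup.coe_add, map_add]
        exact add_mem h2 (huW k)
      · rw [hg_shift]
        have := h3 i
        positivity
    · intro x hx
      have hx1 : toReal (x : V) ∈ openCone fun i => (u i : V) := by
        by_contra h
        exact hx (if_neg h)
      have hx2 : f x ≠ 0 := by
        have : s x = f x := if_pos hx1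
        rwa [this] at hx
      obtain ⟨h1, h2⟩ := (hcone _).1 hx1
      refine ⟨?_, h1, fun i => (h2 i).le⟩
      change (N * ∏ i, R i) • (x : V) ∈ L
      rw [mul_nsmul]
      exact nsmul_mem (hb.mem_of_mem_away_of_mem_integral (hf.nsmul_mem _ hx2)
        (nsmul_mem x.2 N)) _
  -- The `i`-th factor acts first and bounds the `i`-th coordinate; the other factors leave that
  -- coordinate unchanged.
  have hY : ∀ i v, laurentMul (∏ i, geomLaurent (u i) (M i)) s v ≠ 0 →
      v ∈ {v : integralPoints p L | g (toReal (v : V)) i < M i} := by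
    intro i v hv
    rw [← Finset.prod_erase_mul _ _ (Finset.mem_univ i), laurentMul_mul] at hv
    refine mem_of_laurentMul_prod_geomLaurent_ne_zero _ ?_ (fun x hx => ?_) hv
    · intro k hk x hx
      change g _ i < M i
      rw [hg_shift, if_neg (Finset.ne_of_mem_erase hk), add_zero]
      exact hx
    · by_contra hlt
      have hle : (M i : ℝ) ≤ g (toReal (x : V)) i := not_lt.1 hlt
      refine hx ?_
      rw [laurentMul_geomLaurent]
      -- As `g_i(x) ≥ M_i > j`, subtracting `j u_i` keeps the `i`-th coordinate positive, so
      -- membership in the cone does not depend on `j`.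
      have hterm : ∀ j ∈ Finset.range (M i), s (x - j • u i) =
          if toReal (x : V) ∈ W ∧ ∀ k ≠ i, 0 < g (toReal (x : V)) k then
            f ((x : V) - j • (u i : V)) else 0 := by
        intro j hj
        have hj : (j : ℝ) < M i := by exact_mod_cast Finset.mem_range.1 hj
        have hiff : toReal ((x - j • u i : integralPoints p L) : V) ∈
            (openCone fun i => (u i : V)) ↔
            toReal (x : V) ∈ W ∧ ∀ k ≠ i, 0 < g (toReal (x : V)) k := by
          rw [hcone]
          refine and_congr ?_ ⟨fun h k hk => ?_, fun h k => ?_⟩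
          · rw [AddSubgroup.coe_sub, AddSubgroup.coe_nsmul, map_sub, map_nsmul]
            exact W.sub_mem_iff_left (nsmul_mem (huW i) j)
          · have := h k
            rwa [hg_sub, if_neg hk.symm, sub_zero] at this
          · rw [hg_sub]
            split_ifs with hk
            · subst hk
              linarith
            · rw [sub_zero]
              exact h k (Ne.symm hk)
        rw [hs, coneSeries]
        simp only [hiff]
        rfl
      rw [Finset.sum_congr rfl hterm]
      split_ifs with h
      -- The descending progression from `x` is read backwards, starting at `x - (M_i - 1) u_i`.
      · rw [← hM i ((x : V) - (M i - 1 : ℕ) • (u i : V)), ← Finset.sum_range_reflect]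
        refine Finset.sum_congr rfl fun j hj => ?_
        have hj := Finset.mem_range.1 hj
        have h1 : M i - 1 = (M i - 1 - j) + j := by lia
        congr 1
        conv_rhs => rw [h1, add_nsmul]
        abel
      · exact Finset.sum_const_zero
  refine Set.Finite.of_injOn (f := fun v : integralPoints p L => (v : V)) (fun v hv => ?_)
    Subtype.val_injective.injOn (hb.finite_of_bounded hg hR'0 M)
  obtain ⟨h1, h2, h3⟩ := hX v hv
  exact ⟨h1, h2, fun i => ⟨h3 i, (hY i v hv).le⟩⟩

theorem coneSeries_biUnion {κ : Type*} (f : V → ℤ) (T : Finset κ) (c : κ → Set (RealSpace V))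
    (hc : (T : Set κ).PairwiseDisjoint c) :
    coneSeries p L f (⋃ I ∈ T, c I) = ∑ I ∈ T, coneSeries p L f (c I) := by
  classical
  funext v
  rw [Finset.sum_apply]
  by_cases h : toReal (v : V) ∈ ⋃ I ∈ T, c I
  · obtain ⟨I, hI, hv⟩ := Set.mem_iUnion₂.1 h
    rw [Finset.sum_eq_single_of_mem I hI]
    · exact (if_pos h).trans (if_pos hv).symm
    · intro J hJ hJI
      exact if_neg fun hv' => Set.disjoint_left.1 (hc hJ hI hJI) hv' hv
  · refine (if_neg h).trans (Finset.sum_eq_zero fun I hI => ?_).symm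
    exact if_neg fun hv => h (Set.mem_iUnion₂.2 ⟨I, hI, hv⟩)

variable [FiniteDimensional ℚ V] [L.IsLattice ℚ]

theorem isUnit_groupRingToMeasures_geomLaurent (u : integralPoints p L) {M : ℕ} (hM : ¬ p ∣ M) :
    IsUnit (groupRingToMeasures p L (geomLaurent u M)) := by
  simp only [geomLaurent, map_sum, map_pow, groupRingToMeasures_single]
  exact isUnit_sum_dirac_pow p L ⟨toLocal p (u : V), u.2⟩ hM

theorem exists_measure_represents_openCone (hb : IsLatticeBasis L b) {N : ℕ} (hN : N ≠ 0)
    {f : V → ℤ} (hf : HasLevelAway p L N f) {ι : Type*} [Fintype ι] (u : ι → integralPoints p L)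
    (hu : LinearIndependent ℝ fun i => toReal (u i : V)) (M : ι → ℕ) (hM : ∀ i, ¬ p ∣ M i)
    (hsum : ∀ i, ∀ v, ∑ j ∈ Finset.range (M i), f (v + j • (u i : V)) = 0) :
    ∃ ν : Measures p L, Represents (coneSeries p L f (openCone fun i => (u i : V)))
      (algebraMap (Measures p L) (PseudoMeasures p L) ν) := by
  have hfin := finite_support_laurentMul_coneSeries hb hN hf u hu M hsum
  let E := ∏ i, geomLaurent (u i) (M i)
  -- `E` need not be an admissible denominator, but `A E = ∏ (1 - q^{M_i u_i})` is; the numerator is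
  -- multiplied by `A` as well.
  let A : AddMonoidAlgebra ℤ (integralPoints p L) := ∏ i, (1 - AddMonoidAlgebra.single (u i) 1)
  let G : AddMonoidAlgebra ℤ (integralPoints p L) :=
    AddMonoidAlgebra.ofCoeff (Finsupp.ofSupportFinite _ hfin)
  have hE : IsUnit (groupRingToMeasures p L E) := by
    rw [map_prod]
    exact Finset.prod_induction _ IsUnit (fun _ _ => IsUnit.mul) isUnit_one
      fun i _ => isUnit_groupRingToMeasures_geomLaurent (u i) (hM i)
  obtain ⟨κ, hκ⟩ := hE.exists_right_inv
  refine ⟨κ * groupRingToMeasures p L G, A * E, ?_, A * G, ?_, ?_⟩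
  · rw [← Finset.prod_mul_distrib]
    refine Submonoid.prod_mem _ fun i _ => Submonoid.subset_closure ⟨M i • u i, ?_, ?_⟩
    · intro h
      have hMi : M i ≠ 0 := fun h => hM i (h ▸ dvd_zero p)
      have h1 : M i • (u i : V) = 0 := congrArg Subtype.val h
      have h2 : (u i : V) = 0 := by
        rw [← Nat.cast_smul_eq_nsmul ℚ] at h1
        exact (smul_eq_zero.1 h1).resolve_left (Nat.cast_ne_zero.2 hMi)
      refine hu.ne_zero i ?_
      change toReal (u i : V) = 0
      rw [h2, map_zero]
    · exact one_sub_mul_geomLaurent (u i) (M i)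
  · rw [laurentMul_mul, ← laurentMul_coeff]
    rfl
  · have h : groupRingToMeasures p L (A * E) * (κ * groupRingToMeasures p L G) =
        groupRingToMeasures p L (A * G) := by
      rw [map_mul (groupRingToMeasures p L) A E, map_mul (groupRingToMeasures p L) A G, mul_assoc,
        ← mul_assoc (groupRingToMeasures p L E), hκ, one_mul]
    rw [← h]
    exact (map_mul (algebraMap (Measures p L) (PseudoMeasures p L)) _ _).symm

theorem exists_measure_represents_simplicialCone (L : Submodule ℤ V) [L.IsLattice ℚ]
    {f : V → ℤ} (hf : f ∈ testFunctionsAway p L) {r : ℕ} {v : Fin r → V} {C : Set (RealSpace V)}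
    (hC : IsSimplicialCone C v) (hv : ∀ i, VanishingHypothesis p f (v i)) :
    ∃ ν : Measures p L, IsConePseudoMeasure f C
      (algebraMap (Measures p L) (PseudoMeasures p L) ν) := by
  obtain ⟨n, b, hb⟩ := exists_isLatticeBasis L
  obtain ⟨N, hN, hlev⟩ := exists_hasLevelAway Fact.out hb hf
  have hN0 : N ≠ 0 := fun h => hN (h ▸ dvd_zero p)
  obtain ⟨T, hli, -, hdisj, rfl⟩ := hC
  have hone : ∀ I ∈ T, ∃ ν : Measures p L,
      Represents (coneSeries p L f (openCone fun i : I => v i))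
        (algebraMap (Measures p L) (PseudoMeasures p L) ν) := by
    intro I hI
    have hne : ∀ i : I, v i ≠ 0 := fun i h => (hli I hI).ne_zero i (by
      change toReal (v i) = 0
      rw [h, map_zero])
    choose q M hq hM hint hsum using fun i : I =>
      (hv i).exists_integralPoint hb hN hlev (hne i)
    let u : I → integralPoints p L := fun i => ⟨q i • v i, hint i⟩
    have hu : LinearIndependent ℝ fun i => toReal (u i : V) := by
      have := (hli I hI).units_smul fun i => Units.mk0 (q i : ℝ) (Rat.cast_ne_zero.2 (hq i).ne')
      convert this using 2 with i
      exact toReal_smul (q i) (v i)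
    -- Positive rescaling of the generators leaves the open cone unchanged, so the `p`-integral
    -- vectors `q_i v_i` may be used.
    rw [← openCone_smul (fun i : I => v i) hq]
    exact exists_measure_represents_openCone hb hN0 hlev u hu M hM hsum
  choose! ν hν using hone
  refine ⟨∑ I ∈ T, ν I, ?_⟩
  rw [IsConePseudoMeasure, coneSeries_biUnion f T _ hdisj, map_sum]
  exact Represents.sum T hν

end Main

end PadicShintani

theorem mainTheorem2 {V : Type*} [AddCommGroup V] [Module ℚ V] [FiniteDimensional ℚ V]
    (L : Submodule ℤ V) [L.IsLattice ℚ] (p : ℕ) [Fact p.Prime]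
    (f' : V → ℤ) (hf' : f' ∈ testFunctionsAway p L)
    {r : ℕ} (v : Fin r → V) (C : Set (RealSpace V)) (hC : IsSimplicialCone C v)
    (hv : ∀ i, VanishingHypothesis p f' (v i)) :
    (∃! μ : PseudoMeasures p L, IsConePseudoMeasure f' C μ) ∧
      ∀ μ : PseudoMeasures p L, IsConePseudoMeasure f' C μ → IsMeasure μ := by
  obtain ⟨ν, hν⟩ := exists_measure_represents_simplicialCone L hf' hC hv
  exact ⟨⟨_, hν, fun μ hμ => hμ.unique hν⟩, fun μ hμ => ⟨ν, hν.unique hμ⟩⟩
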